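/- Let $\mathbb D$ be the open unit disc of $\mathbb C$. For $f$ analytic on $\mathbb D$ and $0<r<1$ put $$M_p(r,f)=\Big(\int_0^{2\pi}|f(re^{i\theta})|^p\,\frac{d\theta}{2\pi}\Big)^{1/p}\quad(0<p<\infty),\qquad M_\infty(r,f)=\max_{0\le\theta<2\pi}|f(re^{i\theta})|.$$ For $0<p\le\infty$, $0<q<\infty$ and $0<\alpha<\infty$ let $H(p,q,\alpha)$ be the complex vector space of all analytic functions $f$ on $\mathbb D$ with $$\|f\|_{p,q,\alpha}=\Big(\alpha q\int_0^1(1-r)^{\alpha q-1}M_p(r,f)^q\,dr\Big)^{1/q}<\infty .$$ For a linear operator $T$ on $H(p,q,\alpha)$ let $\|T\|=\sup\{\|Tf\|_{p,q,\alpha}:\|f\|_{p,q,\alpha}\le1\}\in[0,\infty]$; $T$ is bounded if $\|T\|<\infty$. A semigroup of analytic functions is a family $(\varphi_t)_{t\ge0}$ of analytic maps $\varphi_t:\mathbb D\to\mathbb D$ such that $\varphi_0$ is the identity, $\varphi_{t+s}=\varphi_t\circ\varphi_s$ for all $t,s\ge0$, and $\varphi_t\to\varphi_0$ uniformly on compact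 subsets of $\mathbb D$ as $t\to0^+$. It is trivial if every $\varphi_t$ is the identity. **Theorem.** Let $0<p\le\infty$, $0<q<\infty$, $0<\alpha<\infty$, and let $(\varphi_t)_{t\ge0}$ be a semigroup of analytic functions. (a) The composition operators $C_tf=f\circ\varphi_t$ are bounded linear operators of $H(p,q,\alpha)$ into itself, $C_0$ is the identity, $C_{t+s}=C_tC_s$ for all $t,s\ge0$, and $(C_t)$ is strongly continuous: $\lim_{t\to0^+}\|C_tf-f\|_{p,q,\alpha}=0$ for every $f\in H(p,q,\alpha)$. (b) If $(\varphi_t)$ is not trivial, then $(C_t)$ is not uniformly continuous, that is, $\|C_t-I\|$ does not tend to $0$ as $t\to0^+$, where $I$ is the identity operator. -/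

import Mathlib

open Set Filter Topology MeasureTheory
open scoped ENNReal NNReal
open scoped Complex.UnitDisc

noncomputable section

namespace MixedNorm

/-- Extension by zero of a function on the unit disc to the complex plane. -/
def discExtend (f : 𝔻 → ℂ) : ℂ → ℂ :=
  Function.extend (fun z : 𝔻 => (z : ℂ)) f 0

/-- `f : 𝔻 → ℂ` is analytic on the unit disc. -/
def IsAnalyticOnDisc (f : 𝔻 → ℂ) : Prop :=
  DifferentiableOn ℂ (discExtend f) (Metric.ball 0 1)

/-- The value `|f(r e^{iθ})|`, as an extended nonnegative real number. -/
def circleAbs (f : 𝔻 → ℂ) (r θ : ℝ) : ℝ≥0∞ :=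
  ‖discExtend f ((r : ℂ) * Complex.exp ((θ : ℂ) * Complex.I))‖ₑ

/-- The integral mean `M_p(r, f)`, for `0 < p ≤ ∞` and `0 ≤ r < 1`:
`(∫_0^{2π} |f(re^{iθ})|^p dθ/(2π))^{1/p}` for finite `p`, and the maximum of `|f(re^{iθ})|` over `θ`
for `p = ∞`. -/
def integralMean (p : ℝ≥0∞) (f : 𝔻 → ℂ) (r : ℝ) : ℝ≥0∞ :=
  if p = ∞ then ⨆ θ ∈ Ico (0 : ℝ) (2 * Real.pi), circleAbs f r θ
  else ((∫⁻ θ in Ico (0 : ℝ) (2 * Real.pi), circleAbs f r θ ^ p.toReal) /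
    ENNReal.ofReal (2 * Real.pi)) ^ (1 / p.toReal)

/-- The (quasi-)norm `‖f‖_{p,q,α}` for finite `q`, with
`‖f‖_{p,q,α}^q = α q ∫_0^1 (1 - r)^{α q - 1} M_p(r, f)^q dr`; it is `∞` when the integral diverges. -/
def mixedNorm (p : ℝ≥0∞) (q α : ℝ) (f : 𝔻 → ℂ) : ℝ≥0∞ :=
  (ENNReal.ofReal (α * q) * ∫⁻ r in Ioo (0 : ℝ) 1,
    ENNReal.ofReal ((1 - r) ^ (α * q - 1)) * integralMean p f r ^ q) ^ (1 / q)

theorem discExtend_coe (f : 𝔻 → ℂ) (z : 𝔻) : discExtend f (z : ℂ) = f z :=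
  Complex.UnitDisc.coe_injective.extend_apply f 0 z

theorem discExtend_of_one_le (f : 𝔻 → ℂ) {z : ℂ} (hz : 1 ≤ ‖z‖) : discExtend f z = 0 := by
  refine Function.extend_apply' _ _ _ ?_
  rintro ⟨w, rfl⟩
  exact absurd w.norm_lt_one (not_lt.2 hz)

theorem discExtend_add (f g : 𝔻 → ℂ) : discExtend (f + g) = discExtend f + discExtend g := by
  funext z
  by_cases hz : ‖z‖ < 1
  · have h := fun k => discExtend_coe k (Complex.UnitDisc.mk z hz)
    simp only [Complex.UnitDisc.coe_mk] at h
    simp [h]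
  · simp [discExtend_of_one_le _ (not_lt.1 hz)]

theorem discExtend_smul (c : ℂ) (f : 𝔻 → ℂ) : discExtend (c • f) = c • discExtend f := by
  funext z
  by_cases hz : ‖z‖ < 1
  · have h := fun k => discExtend_coe k (Complex.UnitDisc.mk z hz)
    simp only [Complex.UnitDisc.coe_mk] at h
    simp [h]
  · simp [discExtend_of_one_le _ (not_lt.1 hz)]

theorem discExtend_zero : discExtend 0 = 0 := by
  simpa using discExtend_smul 0 0

theorem lowerSemicontinuous_enorm_discExtend {f : 𝔻 → ℂ} (hf : IsAnalyticOnDisc f) :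
    LowerSemicontinuous fun z : ℂ => ‖discExtend f z‖ₑ := by
  intro z
  by_cases hz : ‖z‖ < 1
  · have : ContinuousAt (discExtend f) z :=
      (hf.differentiableAt (Metric.isOpen_ball.mem_nhds (by simpa using hz))).continuousAt
    exact this.enorm.lowerSemicontinuousAt
  · intro y hy
    simp [discExtend_of_one_le f (not_lt.1 hz)] at hy

theorem measurable_enorm_discExtend {f : 𝔻 → ℂ} (hf : IsAnalyticOnDisc f) :
    Measurable fun z : ℂ => ‖discExtend f z‖ₑ :=
  (lowerSemicontinuous_enorm_discExtend hf).measurable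

theorem measurable_circleAbs {f : 𝔻 → ℂ} (hf : IsAnalyticOnDisc f) :
    Measurable fun x : ℝ × ℝ => circleAbs f x.1 x.2 :=
  (measurable_enorm_discExtend hf).comp
    (g := fun z : ℂ => ‖discExtend f z‖ₑ)
    (f := fun x : ℝ × ℝ => (x.1 : ℂ) * Complex.exp ((x.2 : ℂ) * Complex.I))
    (by fun_prop)

theorem measurable_integralMean (p : ℝ≥0∞) {f : 𝔻 → ℂ} (hf : IsAnalyticOnDisc f) :
    Measurable (integralMean p f) := by
  unfold integralMean
  by_cases hp : p = ∞
  · simp only [hp, if_true]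
    refine LowerSemicontinuous.measurable ?_
    refine lowerSemicontinuous_biSup fun θ _ => ?_
    exact (lowerSemicontinuous_enorm_discExtend hf).comp
      (g := fun r : ℝ => (r : ℂ) * Complex.exp ((θ : ℂ) * Complex.I)) (by fun_prop)
  · simp only [hp, if_false]
    refine Measurable.pow_const (Measurable.div_const ?_ _) _
    exact Measurable.lintegral_prod_right' (f := fun x : ℝ × ℝ => circleAbs f x.1 x.2 ^ p.toReal)
      ((measurable_circleAbs hf).pow_const _)

theorem circleAbs_add_le (f g : 𝔻 → ℂ) (r θ : ℝ) :
    circleAbs (f + g) r θ ≤ circleAbs f r θ + circleAbs g r θ := by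
  unfold circleAbs
  rw [discExtend_add]
  exact enorm_add_le _ _

theorem exists_rpow_add_le {s : ℝ} (hs : 0 ≤ s) :
    ∃ C : ℝ≥0∞, C ≠ ∞ ∧ ∀ a b : ℝ≥0∞, (a + b) ^ s ≤ C * (a ^ s + b ^ s) := by
  refine ⟨2 ^ s, by simp [ENNReal.rpow_eq_top_iff, not_lt.2 hs], fun a b => ?_⟩
  calc (a + b) ^ s ≤ (2 * max a b) ^ s := by
        gcongr
        rw [two_mul]
        exact add_le_add (le_max_left _ _) (le_max_right _ _)
    _ = 2 ^ s * max a b ^ s := ENNReal.mul_rpow_of_nonneg _ _ hs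
    _ ≤ 2 ^ s * (a ^ s + b ^ s) := by
        gcongr
        rcases le_total a b with h | h
        · rw [max_eq_right h]; exact le_add_self
        · rw [max_eq_left h]; exact le_self_add

theorem exists_integralMean_add_le (p : ℝ≥0∞) {f g : 𝔻 → ℂ} (hf : IsAnalyticOnDisc f) :
    ∃ C : ℝ≥0∞, C ≠ ∞ ∧
      ∀ r, integralMean p (f + g) r ≤ C * (integralMean p f r + integralMean p g r) := by
  by_cases hp : p = ∞
  · refine ⟨1, by simp, fun r => ?_⟩
    simp only [integralMean, hp, if_true, one_mul]
    refine iSup₂_le fun θ hθ => (circleAbs_add_le f g r θ).trans ?_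
    exact add_le_add (le_iSup₂ (f := fun θ _ => circleAbs f r θ) θ hθ)
      (le_iSup₂ (f := fun θ _ => circleAbs g r θ) θ hθ)
  · obtain ⟨C, hC, h⟩ := exists_rpow_add_le (s := p.toReal) ENNReal.toReal_nonneg
    have hs : 0 ≤ 1 / p.toReal := by positivity
    obtain ⟨D, hD, h'⟩ := exists_rpow_add_le hs
    refine ⟨C ^ (1 / p.toReal) * D, ENNReal.mul_ne_top (ENNReal.rpow_ne_top_of_nonneg hs hC) hD,
      fun r => ?_⟩
    simp only [integralMean, hp, if_false]
    have hm : Measurable fun θ => circleAbs f r θ ^ p.toReal :=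
      ((measurable_circleAbs hf).comp measurable_prodMk_left).pow_const _
    rw [mul_assoc]
    refine le_trans ?_ (mul_le_mul_right (h' _ _) _)
    rw [← ENNReal.mul_rpow_of_nonneg _ _ hs]
    refine ENNReal.rpow_le_rpow ?_ hs
    rw [← ENNReal.add_div, ← mul_div_assoc]
    gcongr
    rw [← lintegral_add_left hm, ← lintegral_const_mul' _ _ hC]
    refine lintegral_mono fun θ => ?_
    exact (ENNReal.rpow_le_rpow (circleAbs_add_le f g r θ) ENNReal.toReal_nonneg).trans (h _ _)

theorem mixedNorm_lt_top_iff (p : ℝ≥0∞) {q : ℝ} (hq : 0 < q) (α : ℝ) (f : 𝔻 → ℂ) :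
    mixedNorm p q α f < ∞ ↔ ENNReal.ofReal (α * q) * (∫⁻ r in Ioo (0 : ℝ) 1,
      ENNReal.ofReal ((1 - r) ^ (α * q - 1)) * integralMean p f r ^ q) < ∞ := by
  unfold mixedNorm
  rw [ENNReal.rpow_lt_top_iff_of_pos (by positivity)]

theorem mixedNorm_add_lt_top (p : ℝ≥0∞) {q : ℝ} (hq : 0 < q) (α : ℝ) {f g : 𝔻 → ℂ}
    (hf : IsAnalyticOnDisc f) (hfn : mixedNorm p q α f < ∞) (hgn : mixedNorm p q α g < ∞) :
    mixedNorm p q α (f + g) < ∞ := by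
  rw [mixedNorm_lt_top_iff p hq] at *
  obtain ⟨C, hC, h⟩ := exists_integralMean_add_le p (g := g) hf
  obtain ⟨D, hD, h'⟩ := exists_rpow_add_le hq.le
  have hCq : C ^ q * D ≠ ∞ := ENNReal.mul_ne_top (ENNReal.rpow_ne_top_of_nonneg hq.le hC) hD
  have hm : Measurable fun r : ℝ =>
      ENNReal.ofReal ((1 - r) ^ (α * q - 1)) * integralMean p f r ^ q :=
    (by fun_prop : Measurable fun r : ℝ => ENNReal.ofReal ((1 - r) ^ (α * q - 1))).mul
      ((measurable_integralMean p hf).pow_const q)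
  refine lt_of_le_of_lt ?_ (ENNReal.mul_lt_top hCq.lt_top (ENNReal.add_lt_top.2 ⟨hfn, hgn⟩))
  rw [← mul_add, ← lintegral_add_left hm, mul_left_comm]
  gcongr
  rw [← lintegral_const_mul' _ _ hCq]
  refine lintegral_mono fun r => ?_
  calc ENNReal.ofReal ((1 - r) ^ (α * q - 1)) * integralMean p (f + g) r ^ q
      ≤ ENNReal.ofReal ((1 - r) ^ (α * q - 1)) *
          (C ^ q * (D * (integralMean p f r ^ q + integralMean p g r ^ q))) := by
        gcongr
        refine (ENNReal.rpow_le_rpow (h r) hq.le).trans ?_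
        rw [ENNReal.mul_rpow_of_nonneg _ _ hq.le]
        gcongr
        exact h' _ _
    _ = _ := by ring

theorem integralMean_smul {p : ℝ≥0∞} (hp : 0 < p) (c : ℂ) (f : 𝔻 → ℂ) (r : ℝ) :
    integralMean p (c • f) r = ‖c‖ₑ * integralMean p f r := by
  have h : ∀ θ, circleAbs (c • f) r θ = ‖c‖ₑ * circleAbs f r θ := fun θ => by
    simp [circleAbs, discExtend_smul, enorm_mul]
  by_cases hp' : p = ∞
  · simp only [integralMean, hp', if_true, h, ENNReal.mul_iSup]
  · have hs : 0 < p.toReal := ENNReal.toReal_pos hp.ne' hp'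
    simp only [integralMean, hp', if_false, h, ENNReal.mul_rpow_of_nonneg _ _ hs.le]
    rw [lintegral_const_mul' _ _ (ENNReal.rpow_ne_top_of_nonneg hs.le enorm_ne_top),
      mul_div_assoc, ENNReal.mul_rpow_of_nonneg _ _ (by positivity), ← ENNReal.rpow_mul,
      mul_one_div_cancel hs.ne', ENNReal.rpow_one]

theorem mixedNorm_smul {p : ℝ≥0∞} (hp : 0 < p) {q : ℝ} (hq : 0 < q) (α : ℝ) (c : ℂ) (f : 𝔻 → ℂ) :
    mixedNorm p q α (c • f) = ‖c‖ₑ * mixedNorm p q α f := by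
  unfold mixedNorm
  simp only [integralMean_smul hp, ENNReal.mul_rpow_of_nonneg _ _ hq.le, mul_left_comm _ (‖c‖ₑ ^ q)]
  rw [lintegral_const_mul' _ _ (ENNReal.rpow_ne_top_of_nonneg hq.le enorm_ne_top),
    mul_left_comm, ENNReal.mul_rpow_of_nonneg _ _ (by positivity), ← ENNReal.rpow_mul,
    mul_one_div_cancel hq.ne', ENNReal.rpow_one]

/-- The mixed norm space `H(p, q, α)` for finite `q`: the complex vector space of all analytic
functions `f` on the unit disc with `‖f‖_{p,q,α} < ∞`. -/
def mixedNormSpace (p : ℝ≥0∞) (q α : ℝ) (hp : 0 < p) (hq : 0 < q) : Submodule ℂ (𝔻 → ℂ) where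
  carrier := {f | IsAnalyticOnDisc f ∧ mixedNorm p q α f < ∞}
  add_mem' := by
    rintro f g ⟨hf, hfn⟩ ⟨hg, hgn⟩
    refine ⟨?_, mixedNorm_add_lt_top p hq α hf hfn hgn⟩
    unfold IsAnalyticOnDisc
    rw [discExtend_add]
    exact hf.add hg
  zero_mem' := by
    refine ⟨?_, ?_⟩
    · unfold IsAnalyticOnDisc
      rw [discExtend_zero]
      exact differentiableOn_const 0
    · have h := mixedNorm_smul hp hq α 0 0
      simp only [enorm_zero, zero_mul, smul_zero] at h
      simp [h]
  smul_mem' := by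
    rintro c f ⟨hf, hfn⟩
    refine ⟨?_, ?_⟩
    · unfold IsAnalyticOnDisc
      rw [discExtend_smul]
      exact hf.const_smul c
    · rw [mixedNorm_smul hp hq]
      exact ENNReal.mul_lt_top enorm_lt_top hfn

/-- A one-parameter semigroup of analytic functions on the unit disc. -/
structure IsAnalyticSemigroup (φ : ℝ≥0 → 𝔻 → 𝔻) : Prop where
  analytic : ∀ t, IsAnalyticOnDisc fun z => (φ t z : ℂ)
  zero : φ 0 = id
  add : ∀ t s, φ (t + s) = φ t ∘ φ s
  tendsto : ∀ K : Set 𝔻, IsCompact K →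
    TendstoUniformlyOn (fun t z => (φ t z : ℂ)) (fun z => (φ 0 z : ℂ)) (𝓝[>] 0) K

/-- The semigroup consists of the identity map only. -/
def IsTrivialSemigroup (φ : ℝ≥0 → 𝔻 → 𝔻) : Prop :=
  ∀ t, φ t = id

section Operators

variable {p : ℝ≥0∞} {q α : ℝ} {hp : 0 < p} {hq : 0 < q}

/-- The operator (quasi-)norm on `H(p, q, α)`: the supremum of `‖T f‖` over the unit ball. -/
def operatorNorm (T : mixedNormSpace p q α hp hq →ₗ[ℂ] mixedNormSpace p q α hp hq) : ℝ≥0∞ :=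
  ⨆ (f : mixedNormSpace p q α hp hq) (_ : mixedNorm p q α f ≤ 1), mixedNorm p q α (T f)

/-- A semigroup of bounded linear operators on `H(p, q, α)`. -/
structure IsOperatorSemigroup
    (C : ℝ≥0 → mixedNormSpace p q α hp hq →ₗ[ℂ] mixedNormSpace p q α hp hq) : Prop where
  bounded : ∀ t, operatorNorm (C t) < ∞
  zero : C 0 = LinearMap.id
  add : ∀ t s, C (t + s) = C t ∘ₗ C s

/-- Strong continuity: `‖C_t f - f‖ → 0` as `t → 0⁺`, for every `f` in the space. -/
def IsStronglyContinuous
    (C : ℝ≥0 → mixedNormSpace p q α hp hq →ₗ[ℂ] mixedNormSpace p q α hp hq) : Prop :=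
  ∀ f, Tendsto (fun t => mixedNorm p q α (C t f - f : mixedNormSpace p q α hp hq)) (𝓝[>] 0) (𝓝 0)

/-- Uniform continuity: `‖C_t - I‖ → 0` as `t → 0⁺`. -/
def IsUniformlyContinuous
    (C : ℝ≥0 → mixedNormSpace p q α hp hq →ₗ[ℂ] mixedNormSpace p q α hp hq) : Prop :=
  Tendsto (fun t => operatorNorm (C t - LinearMap.id)) (𝓝[>] 0) (𝓝 0)

/-- The operators `C t` are the composition operators `f ↦ f ∘ φ_t`. -/
def IsInducedBy (C : ℝ≥0 → mixedNormSpace p q α hp hq →ₗ[ℂ] mixedNormSpace p q α hp hq)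
    (φ : ℝ≥0 → 𝔻 → 𝔻) : Prop :=
  ∀ t (f : mixedNormSpace p q α hp hq), (C t f : 𝔻 → ℂ) = (f : 𝔻 → ℂ) ∘ φ t

end Operators

end MixedNorm

end

noncomputable section

namespace MixedNorm

open Metric ComplexConjugate

/-! Boundedness rests on Littlewood subordination for maps that may move the origin. If `ψ` is an
analytic self-map with `|ψ(0)| ≤ a < 1`, Schwarz–Pick puts the image of the circle of radius `r`
inside the disc of radius `R = 1 - (1 - a)/8 * (1 - r)`, and the means of `f ∘ ψ` at `r` are at most
a constant times those of `f` at `R` (`exists_integralMean_comp_le`). Substituting `R` for `r`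
changes the weighted integral only by a constant (`lintegral_weight_mul_comp_le`). All constants
depend on `ψ` only through `a`.

That uniformity gives strong continuity by dominated convergence in `r`, with no density argument:
for small `t` the point `φ_t(0)` is near `0`, so one integrable majorant serves every such `t`,
while uniform convergence on circles makes each mean tend to zero.

For the failure of uniform continuity, every analytic self-map `ψ ≠ id` satisfies `‖C_ψ - I‖ > 1/8`
(`exists_mixedNorm_comp_sub_gt`). By the maximum principle `ψ` moves some points `a` arbitrarily
near the boundary by at least a fixed `δ`. A nearly extremal function for evaluation at `a`, times a
function peaking near `a` and tiny at `ψ(a)`, is the test function. Hence norm continuity at `0`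
would force `φ_t = id` for small `t`, and then for all `t` by iteration. -/

/-! ### Poisson majorant of `|f|^p`, by dividing out zeros. -/

theorem norm_circleAverage_le {E : Type*} [NormedAddCommGroup E] [NormedSpace ℝ E]
    (f : ℂ → E) (c : ℂ) (R : ℝ) :
    ‖Real.circleAverage f c R‖ ≤ Real.circleAverage (fun z => ‖f z‖) c R := by
  rw [Real.circleAverage_def, Real.circleAverage_def, norm_smul, Real.norm_of_nonneg
    (by positivity), smul_eq_mul]
  gcongr
  exact intervalIntegral.norm_integral_le_integral_norm Real.two_pi_pos.le

theorem re_herglotzRieszKernel_nonneg {w z : ℂ} {R : ℝ} (hz : z ∈ sphere 0 R) (hw : w ∈ ball 0 R) :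
    0 ≤ (herglotzRieszKernel 0 w z).re := by
  have h := le_re_herglotzRieszKernel hz hw
  rw [herglotzRieszKernel_def]
  refine le_trans ?_ h
  have : ‖w‖ < R := by simpa using hw
  have h0 := norm_nonneg w
  rw [sub_zero]
  apply div_nonneg <;> linarith

/-- Compactness makes the divisor of `f` finite. Extracting the zeros gives equality only off a
discrete set; since the closed disc has no isolated points, continuity of both sides extends it to
every point. -/
theorem exists_eq_prod_mul {f : ℂ → ℂ} {R : ℝ} (hR : 0 < R)
    (hf : AnalyticOnNhd ℂ f (closedBall 0 R)) (h0 : ∃ z ∈ closedBall (0 : ℂ) R, f z ≠ 0) :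
    ∃ (s : Finset ℂ) (n : ℂ → ℕ) (g : ℂ → ℂ), (∀ u ∈ s, u ∈ closedBall (0 : ℂ) R) ∧
      AnalyticOnNhd ℂ g (closedBall 0 R) ∧ (∀ z ∈ closedBall (0 : ℂ) R, g z ≠ 0) ∧
      ∀ z ∈ closedBall (0 : ℂ) R, f z = (∏ u ∈ s, (z - u) ^ n u) * g z := by
  have hacc : ∀ x ∈ closedBall (0 : ℂ) R, AccPt x (𝓟 (closedBall (0 : ℂ) R)) := fun x hx =>
    (convex_closedBall (0 : ℂ) R).isPreconnected.preperfect_of_nontrivial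
      ((nontrivial_of_mem_mem_ne (x := 0) (y := (R : ℂ)) (by simp [hR.le])
        (by simp [abs_of_pos hR]) (by exact_mod_cast hR.ne))) x hx
  have hconn : IsConnected (closedBall (0 : ℂ) R) :=
    ⟨⟨0, by simp [hR.le]⟩, (convex_closedBall (0 : ℂ) R).isPreconnected⟩
  have hord : ∀ u : closedBall (0 : ℂ) R, meromorphicOrderAt f u ≠ ⊤ := by
    rw [← hf.meromorphicOn.exists_meromorphicOrderAt_ne_top_iff_forall hconn]
    obtain ⟨z, hz, hfz⟩ := h0
    refine ⟨⟨z, hz⟩, ?_⟩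
    rw [(hf z hz).meromorphicNFAt.meromorphicOrderAt_eq_zero_iff.2 hfz]
    exact WithTop.coe_ne_top
  set D := MeromorphicOn.divisor f (closedBall (0 : ℂ) R) with hD
  have hfin : D.support.Finite := D.finiteSupport (isCompact_closedBall 0 R)
  obtain ⟨g, hg, hg0, hfg⟩ := hf.meromorphicOn.extract_zeros_poles hord hfin
  have hpos : 0 ≤ D := MeromorphicOn.AnalyticOnNhd.divisor_nonneg hf
  refine ⟨hfin.toFinset, fun u => (D u).toNat, g, ?_, hg, fun z hz => hg0 ⟨z, hz⟩, ?_⟩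
  · intro u hu
    exact D.supportWithinDomain ((Set.Finite.mem_toFinset hfin).1 hu)
  · intro z hz
    have heq : (∏ᶠ u, (· - u) ^ D u) • g =
        fun z => (∏ u ∈ hfin.toFinset, (z - u) ^ (D u).toNat) * g z := by
      rw [finprod_eq_prod_of_mulSupport_subset (s := hfin.toFinset)]
      · funext z
        simp only [Pi.smul_apply', Finset.prod_apply, Pi.pow_apply, smul_eq_mul]
        congr 1
        refine Finset.prod_congr rfl fun u _ => ?_
        rw [← zpow_natCast, Int.toNat_of_nonneg (hpos u)]
      · intro u hu
        simp only [Function.mem_mulSupport] at hu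
        simp only [Set.Finite.coe_toFinset, Function.mem_support]
        intro h
        exact hu (by simp [h])
    rw [heq] at hfg
    have han : AnalyticAt ℂ (fun z => (∏ u ∈ hfin.toFinset, (z - u) ^ (D u).toNat) * g z) z :=
      (Finset.analyticAt_fun_prod _ fun u _ => by fun_prop).mul (hg z hz)
    have := (hf z hz).meromorphicAt.eventuallyEq_nhdsNE_of_eventuallyEq_codiscreteWithin
      han.meromorphicAt hz (hacc z hz) hfg
    exact (((hf z hz).continuousAt.eventuallyEq_nhds_iff_eventuallyEq_nhdsNE
      han.continuousAt).1 this).eq_of_nhds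

/-- The function `z - u` divided by the Blaschke factor at `u`. -/
def blaschkeQuotient (R : ℝ) (u z : ℂ) : ℂ :=
  if ‖u‖ < R then (R ^ 2 - conj u * z) / R else z - u

theorem analyticAt_blaschkeQuotient (R : ℝ) (u z : ℂ) :
    AnalyticAt ℂ (blaschkeQuotient R u) z := by
  unfold blaschkeQuotient
  split_ifs
  · simp only [div_eq_mul_inv]
    fun_prop
  · fun_prop

theorem blaschkeQuotient_ne_zero {R : ℝ} {u z : ℂ} (hz : ‖z‖ < R) :
    blaschkeQuotient R u z ≠ 0 := by
  have hR : 0 < R := (norm_nonneg z).trans_lt hz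
  unfold blaschkeQuotient
  split_ifs with h
  · have : (R : ℂ) ≠ 0 := by exact_mod_cast hR.ne'
    refine div_ne_zero (sub_ne_zero.2 fun h' => ?_) this
    have h2 := congrArg norm h'
    simp only [norm_pow, Complex.norm_real, norm_mul, RCLike.norm_conj,
      Real.norm_of_nonneg hR.le] at h2
    nlinarith [norm_nonneg z, norm_nonneg u]
  · refine sub_ne_zero.2 fun h' => h (h' ▸ hz)

/-- The right side is nonnegative for `u`, `z` in the disc and vanishes when `z` is on the circle:
Blaschke factors have modulus at most one inside and exactly one on the boundary. With `R = 1` it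
also serves Schwarz–Pick. -/
theorem norm_sq_blaschke_identity (R : ℝ) (u z : ℂ) :
    ‖(R : ℂ) ^ 2 - conj u * z‖ ^ 2 - R ^ 2 * ‖z - u‖ ^ 2 =
      (R ^ 2 - ‖z‖ ^ 2) * (R ^ 2 - ‖u‖ ^ 2) := by
  rw [← Complex.normSq_eq_norm_sq, ← Complex.normSq_eq_norm_sq, ← Complex.normSq_eq_norm_sq,
    ← Complex.normSq_eq_norm_sq]
  simp only [Complex.normSq_apply, Complex.sub_re, Complex.sub_im, Complex.mul_re, Complex.mul_im,
    Complex.conj_re, Complex.conj_im, sq, Complex.ofReal_re, Complex.ofReal_im]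
  ring

theorem norm_sub_le_norm_blaschkeQuotient {R : ℝ} {u z : ℂ} (hR : 0 < R) (hz : ‖z‖ ≤ R) :
    ‖z - u‖ ≤ ‖blaschkeQuotient R u z‖ := by
  unfold blaschkeQuotient
  split_ifs with h
  · rw [norm_div, Complex.norm_real, Real.norm_of_nonneg hR.le, le_div_iff₀ hR]
    refine le_of_sq_le_sq ?_ (norm_nonneg _)
    have := norm_sq_blaschke_identity R u z
    have h1 : 0 ≤ (R ^ 2 - ‖z‖ ^ 2) * (R ^ 2 - ‖u‖ ^ 2) :=
      mul_nonneg (by nlinarith [norm_nonneg z]) (by nlinarith [norm_nonneg u])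
    nlinarith
  · exact le_rfl

theorem norm_blaschkeQuotient_of_norm_eq {R : ℝ} {u z : ℂ} (hR : 0 < R) (hz : ‖z‖ = R) :
    ‖blaschkeQuotient R u z‖ = ‖z - u‖ := by
  unfold blaschkeQuotient
  split_ifs with h
  · rw [norm_div, Complex.norm_real, Real.norm_of_nonneg hR.le, div_eq_iff hR.ne']
    refine (sq_eq_sq₀ (norm_nonneg _) (by positivity)).1 ?_
    have := norm_sq_blaschke_identity R u z
    rw [hz] at this
    nlinarith
  · rfl

/-- Dividing `f` by the Blaschke factors of its interior zeros can only increase its modulus inside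
and leaves it unchanged on the circle. Zeros on the circle itself stay, so `G` is zero-free only in
the open disc. -/
theorem exists_nonvanishing_majorant {f : ℂ → ℂ} {R : ℝ} (hR : 0 < R)
    (hf : AnalyticOnNhd ℂ f (closedBall 0 R)) (h0 : ∃ z ∈ closedBall (0 : ℂ) R, f z ≠ 0) :
    ∃ G : ℂ → ℂ, AnalyticOnNhd ℂ G (closedBall 0 R) ∧ (∀ z ∈ ball (0 : ℂ) R, G z ≠ 0) ∧
      (∀ z ∈ ball (0 : ℂ) R, ‖f z‖ ≤ ‖G z‖) ∧ ∀ z ∈ sphere (0 : ℂ) R, ‖G z‖ = ‖f z‖ := by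
  obtain ⟨s, n, g, -, hg, hg0, hfg⟩ := exists_eq_prod_mul hR hf h0
  refine ⟨fun z => (∏ u ∈ s, blaschkeQuotient R u z ^ n u) * g z, fun z hz => ?_, fun z hz => ?_,
    fun z hz => ?_, fun z hz => ?_⟩
  · exact (Finset.analyticAt_fun_prod _ fun u _ =>
      (analyticAt_blaschkeQuotient R u z).fun_pow _).mul (hg z hz)
  · exact mul_ne_zero (Finset.prod_ne_zero_iff.2 fun u _ =>
      pow_ne_zero _ (blaschkeQuotient_ne_zero (by simpa using hz)))
      (hg0 z (ball_subset_closedBall hz))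
  · have hz' := ball_subset_closedBall hz
    rw [hfg z hz', norm_mul, norm_mul, norm_prod, norm_prod]
    simp only [norm_pow]
    gcongr
    exact norm_sub_le_norm_blaschkeQuotient hR (by simpa using hz')
  · have hz' := sphere_subset_closedBall hz
    rw [hfg z hz', norm_mul, norm_mul, norm_prod, norm_prod]
    simp only [norm_pow, norm_blaschkeQuotient_of_norm_eq hR (mem_sphere_zero_iff_norm.1 hz)]

theorem continuousOn_herglotzRieszKernel (w : ℂ) :
    ContinuousOn (herglotzRieszKernel 0 w) {z | ‖w‖ < ‖z‖} := by
  rw [herglotzRieszKernel_fun_def]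
  refine ContinuousOn.div (by fun_prop) (by fun_prop) fun z hz h => ?_
  rw [sub_zero, sub_zero, sub_eq_zero] at h
  exact absurd (congrArg norm h) (ne_of_gt hz)

/-- As `log |G|` is harmonic it is the real part of some analytic `F`, and `|G|^p` is the modulus of
the analytic function `exp (p F)`, to which the Poisson formula applies. Because `G` may vanish on
the boundary, this is done on radii `r < R`, followed by `r → R`. -/
theorem rpow_norm_le_circleAverage_of_ne_zero {G : ℂ → ℂ} {R p : ℝ} (hp : 0 < p)
    (hG : AnalyticOnNhd ℂ G (closedBall 0 R)) (hG0 : ∀ z ∈ ball (0 : ℂ) R, G z ≠ 0) {w : ℂ}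
    (hw : w ∈ ball 0 R) :
    ‖G w‖ ^ p ≤
      Real.circleAverage (fun z => (herglotzRieszKernel 0 w z).re * ‖G z‖ ^ p) 0 R := by
  have hwR : ‖w‖ < R := by simpa using hw
  have hharm : InnerProductSpace.HarmonicOnNhd (fun z => Real.log ‖G z‖) (ball 0 R) := fun z hz =>
    (hG z (ball_subset_closedBall hz)).harmonicAt_log_norm (hG0 z hz)
  obtain ⟨F, hF, hFG⟩ := hharm.exists_analyticOnNhd_ball_re_eq
  set H : ℂ → ℂ := fun z => Complex.exp (p * F z)
  have hH : ∀ z ∈ ball (0 : ℂ) R, ‖H z‖ = ‖G z‖ ^ p := fun z hz => by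
    have h1 : (F z).re = Real.log ‖G z‖ := hFG hz
    simp only [H, Complex.norm_exp, Complex.re_ofReal_mul, h1]
    rw [Real.rpow_def_of_pos (norm_pos_iff.2 (hG0 z hz)), mul_comm]
  have hHd : DifferentiableOn ℂ H (ball 0 R) :=
    (hF.differentiableOn.const_mul _).cexp
  have hle : ∀ r ∈ Ioo ‖w‖ R, ‖G w‖ ^ p ≤
      Real.circleAverage (fun z => (herglotzRieszKernel 0 w z).re * ‖G z‖ ^ p) 0 r := by
    intro r hr
    have hr0 : 0 < r := (norm_nonneg w).trans_lt hr.1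
    have hwr : w ∈ ball (0 : ℂ) r := by simpa using hr.1
    have hd : DiffContOnCl ℂ H (ball 0 r) :=
      (hHd.mono (closure_ball_subset_closedBall.trans (closedBall_subset_ball hr.2))).diffContOnCl
    have h1 := hd.circleAverage_re_herglotzRieszKernel_smul hwr
    rw [← hH w hw, ← h1]
    refine (norm_circleAverage_le _ _ _).trans_eq (Real.circleAverage_congr_sphere fun z hz => ?_)
    rw [abs_of_pos hr0] at hz
    have hzR : z ∈ ball (0 : ℂ) R := by
      have : ‖z‖ = r := by simpa using hz
      simpa [this] using hr.2
    simp only [Pi.smul_apply', Function.comp_apply, norm_smul, hH z hzR]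
    rw [Real.norm_of_nonneg (re_herglotzRieszKernel_nonneg hz hwr)]
  have hcont : ContinuousOn (Real.circleAverage
      (fun z => (herglotzRieszKernel 0 w z).re * ‖G z‖ ^ p) 0) (Ioc ‖w‖ R) := by
    refine Real.ContinuousOn.circleAverage ?_ fun r hr => (norm_nonneg w).trans hr.1.le
    refine ContinuousOn.mul ?_ ?_
    · exact Complex.continuous_re.comp_continuousOn
        ((continuousOn_herglotzRieszKernel w).mono fun z hz => by simpa using hz.1)
    · refine ContinuousOn.rpow_const ?_ fun _ _ => Or.inr hp.le
      exact (hG.continuousOn.mono fun z hz => by simpa using hz.2).norm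
  have hmem : R ∈ closure (Ioo ‖w‖ R) := by
    rw [closure_Ioo hwR.ne]
    exact right_mem_Icc.2 hwR.le
  exact ContinuousWithinAt.closure_le hmem continuousWithinAt_const
    ((hcont R (right_mem_Ioc.2 hwR)).mono Ioo_subset_Ioc_self) hle

theorem rpow_norm_le_circleAverage {f : ℂ → ℂ} {R p : ℝ} (hp : 0 < p)
    (hf : AnalyticOnNhd ℂ f (closedBall 0 R)) {w : ℂ} (hw : w ∈ ball 0 R) :
    ‖f w‖ ^ p ≤
      Real.circleAverage (fun z => (herglotzRieszKernel 0 w z).re * ‖f z‖ ^ p) 0 R := by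
  have hR : 0 < R := pos_of_mem_ball hw
  by_cases h0 : ∃ z ∈ closedBall (0 : ℂ) R, f z ≠ 0
  · obtain ⟨G, hG, hG0, hle, heq⟩ := exists_nonvanishing_majorant hR hf h0
    calc ‖f w‖ ^ p ≤ ‖G w‖ ^ p := by
          gcongr
          exact hle w hw
      _ ≤ _ := rpow_norm_le_circleAverage_of_ne_zero hp hG hG0 hw
      _ = _ := Real.circleAverage_congr_sphere fun z hz => by
          rw [abs_of_pos hR] at hz
          simp only [heq z hz]
  · push Not at h0
    rw [h0 w (ball_subset_closedBall hw), norm_zero, Real.zero_rpow hp.ne']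
    refine Real.circleAverage_nonneg_of_nonneg fun z hz => ?_
    rw [abs_of_pos hR] at hz
    exact mul_nonneg (re_herglotzRieszKernel_nonneg hz hw) (by positivity)

/-! ### Littlewood's inequality and Schwarz–Pick. -/

/-- **Littlewood's inequality** for an analytic map that need not fix the origin. -/
theorem circleAverage_rpow_norm_comp_le {f Φ : ℂ → ℂ} {R r p : ℝ} (hp : 0 < p) (hr : 0 < r)
    (hf : AnalyticOnNhd ℂ f (closedBall 0 R)) (hΦ : AnalyticOnNhd ℂ Φ (closedBall 0 r))
    (hmaps : MapsTo Φ (closedBall 0 r) (ball 0 R)) :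
    Real.circleAverage (fun z => ‖f (Φ z)‖ ^ p) 0 r ≤
      (R + ‖Φ 0‖) / (R - ‖Φ 0‖) * Real.circleAverage (fun z => ‖f z‖ ^ p) 0 R := by
  have h0 : Φ 0 ∈ ball (0 : ℂ) R := hmaps (by simp [hr.le])
  have hR : 0 < R := pos_of_mem_ball h0
  set g : ℂ → ℝ := fun z => ‖f z‖ ^ p
  have hgc : ContinuousOn g (closedBall 0 R) :=
    hf.continuousOn.norm.rpow_const fun _ _ => Or.inr hp.le
  have hgi : CircleIntegrable g 0 R :=
    (hgc.mono sphere_subset_closedBall).circleIntegrable hR.le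
  have hgi' : CircleIntegrable (fun ζ => (g ζ : ℂ)) 0 R :=
    (Complex.continuous_ofReal.comp_continuousOn
      (hgc.mono sphere_subset_closedBall)).circleIntegrable hR.le
  -- `H` is analytic and its real part is the Poisson integral of `|f|^p`. The mean value property
  -- of `H ∘ Φ` then evaluates the average of the majorant as its value at `Φ 0`, where the kernel
  -- bound gives the constant.
  set H : ℂ → ℂ := fun w =>
    Real.circleAverage (fun ζ => herglotzRieszKernel 0 w ζ • (g ζ : ℂ)) 0 R with hHdef
  have hH : DifferentiableOn ℂ H (ball 0 R) :=
    differentiableOn_circleAverage_herglotzRieszKernel_smul hgi'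
  have hHre : ∀ w ∈ ball (0 : ℂ) R, (H w).re =
      Real.circleAverage (fun z => (herglotzRieszKernel 0 w z).re * g z) 0 R := fun w hw =>
    re_circleAverage_herglotzRieszKernel_smul hgi hw
  have hcomp : DifferentiableOn ℂ (H ∘ Φ) (closedBall 0 r) :=
    hH.comp hΦ.differentiableOn hmaps
  have hmean : Real.circleAverage (H ∘ Φ) 0 r = H (Φ 0) := by
    have : DiffContOnCl ℂ (H ∘ Φ) (ball 0 |r|) := by
      rw [abs_of_pos hr]
      exact (hcomp.mono closure_ball_subset_closedBall).diffContOnCl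
    exact this.circleAverage
  have hint : CircleIntegrable (H ∘ Φ) 0 r :=
    (hcomp.continuousOn.mono sphere_subset_closedBall).circleIntegrable hr.le
  have hmean' : Real.circleAverage (fun z => (H (Φ z)).re) 0 r = (H (Φ 0)).re := by
    rw [← hmean]
    exact Complex.reCLM.circleAverage_comp_comm hint
  have hint' : CircleIntegrable (fun z => (H (Φ z)).re) 0 r :=
    (Complex.continuous_re.comp_continuousOn
      (hcomp.continuousOn.mono sphere_subset_closedBall)).circleIntegrable hr.le
  have hfΦ : ContinuousOn (fun z => ‖f (Φ z)‖ ^ p) (closedBall 0 r) :=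
    hgc.comp hΦ.continuousOn (hmaps.mono_right ball_subset_closedBall)
  calc Real.circleAverage (fun z => ‖f (Φ z)‖ ^ p) 0 r
      ≤ Real.circleAverage (fun z => (H (Φ z)).re) 0 r := by
        refine Real.circleAverage_mono
          ((hfΦ.mono sphere_subset_closedBall).circleIntegrable hr.le) hint' fun z hz => ?_
        rw [abs_of_pos hr] at hz
        have hz' := hmaps (sphere_subset_closedBall hz)
        rw [hHre _ hz']
        exact rpow_norm_le_circleAverage hp hf hz'
    _ = Real.circleAverage (fun z => (herglotzRieszKernel 0 (Φ 0) z).re * g z) 0 R := by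
        rw [hmean', hHre _ h0]
    _ ≤ Real.circleAverage (fun z => (R + ‖Φ 0‖) / (R - ‖Φ 0‖) * g z) 0 R := by
        refine Real.circleAverage_mono ?_ ?_ fun z hz => ?_
        · refine ContinuousOn.circleIntegrable hR.le (ContinuousOn.mul ?_
            (hgc.mono sphere_subset_closedBall))
          refine Complex.continuous_re.comp_continuousOn ?_
          simpa [abs_of_pos hR] using continuousOn_herglotzRieszKernel_sphere h0
        · exact ((hgc.mono sphere_subset_closedBall).const_mul _).circleIntegrable hR.le
        · rw [abs_of_pos hR] at hz
          have := re_herglotzRieszKernel_le hz h0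
          rw [sub_zero (Φ 0)] at this
          refine mul_le_mul_of_nonneg_right ?_ (by positivity)
          rw [herglotzRieszKernel_def, sub_zero (Φ 0)]
          exact this
    _ = _ := by
        simpa only [smul_eq_mul] using Real.circleAverage_fun_smul (f := g)
          (a := (R + ‖Φ 0‖) / (R - ‖Φ 0‖)) (c := 0) (R := R)

/-- A weak form of the **Schwarz–Pick lemma**. -/
theorem mul_one_sub_norm_le_one_sub_norm {Φ : ℂ → ℂ} (hΦ : DifferentiableOn ℂ Φ (ball 0 1))
    (hmaps : MapsTo Φ (ball 0 1) (ball 0 1)) {z : ℂ} (hz : z ∈ ball (0 : ℂ) 1) :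
    (1 - ‖Φ 0‖) / 4 * (1 - ‖z‖) ≤ 1 - ‖Φ z‖ := by
  have hlt : ∀ z ∈ ball (0 : ℂ) 1, ‖Φ z‖ < 1 := fun z hz => by simpa using hmaps hz
  set b := Φ 0
  have hb : ‖b‖ < 1 := hlt 0 (by simp)
  have hne : ∀ z ∈ ball (0 : ℂ) 1, 1 - ‖b‖ ≤ ‖1 - conj b * Φ z‖ := fun z hz => by
    have h1 := norm_sub_norm_le (1 : ℂ) (conj b * Φ z)
    rw [norm_one, norm_mul, RCLike.norm_conj] at h1
    nlinarith [hlt z hz, norm_nonneg b, norm_nonneg (Φ z)]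
  have hne0 : ∀ z ∈ ball (0 : ℂ) 1, 1 - conj b * Φ z ≠ 0 := fun z hz h => by
    have := hne z hz
    rw [h, norm_zero] at this
    linarith
  have hid : ∀ w, ‖1 - conj b * w‖ ^ 2 - ‖w - b‖ ^ 2 = (1 - ‖w‖ ^ 2) * (1 - ‖b‖ ^ 2) := fun w => by
    simpa using norm_sq_blaschke_identity 1 b w
  -- `Φ` followed by the disc automorphism sending `b` to `0`, so that the Schwarz lemma applies.
  set g : ℂ → ℂ := fun z => (Φ z - b) / (1 - conj b * Φ z)
  have hg : DifferentiableOn ℂ g (ball 0 1) :=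
    (hΦ.sub_const b).div ((hΦ.const_mul _).const_sub 1) hne0
  have hgm : MapsTo g (ball 0 1) (closedBall 0 1) := fun z hz => by
    have hpos : 0 < ‖1 - conj b * Φ z‖ := norm_pos_iff.2 (hne0 z hz)
    simp only [mem_closedBall, dist_zero_right, g, norm_div]
    rw [div_le_one hpos]
    refine le_of_sq_le_sq ?_ (norm_nonneg _)
    have h1 : 0 ≤ (1 - ‖Φ z‖ ^ 2) * (1 - ‖b‖ ^ 2) := mul_nonneg
      (by nlinarith [hlt z hz, norm_nonneg (Φ z)]) (by nlinarith [norm_nonneg b])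
    linarith [hid (Φ z)]
  have hz' : ‖z‖ < 1 := by simpa using hz
  have hS := Complex.norm_le_norm_of_mapsTo_ball hg hgm (by simp [g, b]) hz'
  have hpos : 0 < ‖1 - conj b * Φ z‖ := norm_pos_iff.2 (hne0 z hz)
  have hS' : ‖Φ z - b‖ ≤ ‖z‖ * ‖1 - conj b * Φ z‖ := by
    simp only [g, norm_div] at hS
    rwa [div_le_iff₀ hpos] at hS
  have h2 : ‖Φ z - b‖ ^ 2 ≤ ‖z‖ ^ 2 * ‖1 - conj b * Φ z‖ ^ 2 := by
    rw [← mul_pow]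
    gcongr
  have h3 := hid (Φ z)
  have h4 := hne z hz
  have hn := norm_nonneg z
  have hbn := norm_nonneg b
  have hwn := norm_nonneg (Φ z)
  have hw := hlt z hz
  have h5 : (1 - ‖z‖ ^ 2) * (1 - ‖b‖) ^ 2 ≤ (1 - ‖Φ z‖ ^ 2) * (1 - ‖b‖ ^ 2) := by
    calc (1 - ‖z‖ ^ 2) * (1 - ‖b‖) ^ 2 ≤ (1 - ‖z‖ ^ 2) * ‖1 - conj b * Φ z‖ ^ 2 := by
          have : 0 ≤ 1 - ‖z‖ ^ 2 := by nlinarith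
          have : 0 ≤ 1 - ‖b‖ := by linarith
          gcongr
      _ ≤ _ := by linarith
  have h6 : (1 - ‖z‖ ^ 2) * (1 - ‖b‖) ≤ (1 - ‖Φ z‖ ^ 2) * (1 + ‖b‖) := by
    refine le_of_mul_le_mul_right ?_ (sub_pos.2 hb)
    linarith
  have h7 : (1 - ‖z‖) * (1 - ‖b‖) ≤ (1 - ‖z‖ ^ 2) * (1 - ‖b‖) := by
    have : 0 ≤ 1 - ‖b‖ := by linarith
    gcongr
    nlinarith
  have h8 : (1 - ‖Φ z‖ ^ 2) * (1 + ‖b‖) ≤ (2 * (1 - ‖Φ z‖)) * 2 := by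
    refine mul_le_mul ?_ (by linarith) (by linarith) (by linarith)
    nlinarith
  linarith

/-! ### Integral means on the disc and their behaviour under composition. -/

theorem discExtend_of_mem_ball (f : 𝔻 → ℂ) {z : ℂ} (hz : z ∈ ball (0 : ℂ) 1) :
    discExtend f z = f (Complex.UnitDisc.mk z (by simpa using hz)) :=
  discExtend_coe f (Complex.UnitDisc.mk z (by simpa using hz))

theorem discExtend_comp (f : 𝔻 → ℂ) (ψ : 𝔻 → 𝔻) {z : ℂ} (hz : z ∈ ball (0 : ℂ) 1) :
    discExtend (f ∘ ψ) z = discExtend f (discExtend (fun w => (ψ w : ℂ)) z) := by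
  rw [discExtend_of_mem_ball _ hz, discExtend_of_mem_ball _ hz, discExtend_coe]
  rfl

theorem mapsTo_discExtend (ψ : 𝔻 → 𝔻) :
    MapsTo (discExtend fun w => (ψ w : ℂ)) (ball 0 1) (ball 0 1) := fun z hz => by
  rw [discExtend_of_mem_ball _ hz]
  simpa using (ψ _).norm_lt_one

theorem IsAnalyticOnDisc.comp {f : 𝔻 → ℂ} (hf : IsAnalyticOnDisc f) {ψ : 𝔻 → 𝔻}
    (hψ : IsAnalyticOnDisc fun z => (ψ z : ℂ)) : IsAnalyticOnDisc (f ∘ ψ) := by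
  have h : DifferentiableOn ℂ (discExtend f ∘ discExtend fun w => (ψ w : ℂ)) (ball 0 1) :=
    DifferentiableOn.comp hf hψ (mapsTo_discExtend ψ)
  exact h.congr fun z hz => discExtend_comp f ψ hz

theorem IsAnalyticOnDisc.sub {f g : 𝔻 → ℂ} (hf : IsAnalyticOnDisc f) (hg : IsAnalyticOnDisc g) :
    IsAnalyticOnDisc (f - g) := by
  refine (DifferentiableOn.sub hf hg).congr fun z hz => ?_
  simp [discExtend_of_mem_ball _ hz]

theorem IsAnalyticOnDisc.mul {f g : 𝔻 → ℂ} (hf : IsAnalyticOnDisc f) (hg : IsAnalyticOnDisc g) :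
    IsAnalyticOnDisc (f * g) := by
  refine (DifferentiableOn.mul hf hg).congr fun z hz => ?_
  simp [discExtend_of_mem_ball _ hz]

theorem isAnalyticOnDisc_of_differentiable {F : ℂ → ℂ} (hF : Differentiable ℂ F) :
    IsAnalyticOnDisc fun z : 𝔻 => F z :=
  hF.differentiableOn.congr fun z hz => by rw [discExtend_of_mem_ball _ hz]; rfl

theorem IsAnalyticOnDisc.analyticOnNhd {f : 𝔻 → ℂ} (hf : IsAnalyticOnDisc f) {r : ℝ} (hr : r < 1) :
    AnalyticOnNhd ℂ (discExtend f) (closedBall 0 r) :=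
  (DifferentiableOn.analyticOnNhd hf isOpen_ball).mono (closedBall_subset_ball hr)

theorem circleAbs_eq (f : 𝔻 → ℂ) (r θ : ℝ) : circleAbs f r θ = ‖discExtend f (circleMap 0 r θ)‖ₑ := by
  simp [circleAbs, circleMap]

theorem circleMap_mem_ball_one {r : ℝ} (hr : r ∈ Ioo (0 : ℝ) 1) (θ : ℝ) :
    circleMap 0 r θ ∈ ball (0 : ℂ) 1 := by
  simpa [abs_of_pos hr.1] using hr.2

theorem ofReal_circleAverage {g : ℂ → ℝ} {r : ℝ} (hr : 0 ≤ r) (hg : ContinuousOn g (sphere 0 r))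
    (h0 : ∀ z ∈ sphere (0 : ℂ) r, 0 ≤ g z) :
    ENNReal.ofReal (Real.circleAverage g 0 r) =
      (∫⁻ θ in Ico (0 : ℝ) (2 * Real.pi), ENNReal.ofReal (g (circleMap 0 r θ))) /
        ENNReal.ofReal (2 * Real.pi) := by
  have hi : CircleIntegrable g 0 r := hg.circleIntegrable hr
  have hi' := (intervalIntegrable_iff_integrableOn_Ioc_of_le Real.two_pi_pos.le).1 hi
  rw [Real.circleAverage_def, smul_eq_mul, mul_comm, ← div_eq_mul_inv,
    ENNReal.ofReal_div_of_pos Real.two_pi_pos,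
    intervalIntegral.integral_of_le Real.two_pi_pos.le,
    ofReal_integral_eq_lintegral_ofReal hi'
      (Eventually.of_forall fun θ => h0 _ (circleMap_mem_sphere 0 hr θ)),
    Measure.restrict_congr_set Ico_ae_eq_Ioc]

theorem integralMean_eq_circleAverage {p : ℝ≥0∞} (hp : 0 < p) (hp' : p ≠ ∞) {f : 𝔻 → ℂ}
    (hf : IsAnalyticOnDisc f) {r : ℝ} (hr : r ∈ Ioo (0 : ℝ) 1) :
    integralMean p f r =
      ENNReal.ofReal (Real.circleAverage (fun z => ‖discExtend f z‖ ^ p.toReal) 0 r) ^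
        (1 / p.toReal) := by
  have hs : 0 < p.toReal := ENNReal.toReal_pos hp.ne' hp'
  have hc : ContinuousOn (fun z => ‖discExtend f z‖ ^ p.toReal) (sphere 0 r) :=
    ((hf.analyticOnNhd hr.2).continuousOn.mono sphere_subset_closedBall).norm.rpow_const
      fun _ _ => Or.inr hs.le
  rw [ofReal_circleAverage hr.1.le hc fun _ _ => by positivity]
  simp only [integralMean, hp', if_false, circleAbs_eq]
  congr 3
  funext θ
  rw [← ofReal_norm, ENNReal.ofReal_rpow_of_nonneg (norm_nonneg _) hs.le]

theorem exists_circleMap_eq {z : ℂ} {r : ℝ} (hz : ‖z‖ = r) :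
    ∃ θ ∈ Ico (0 : ℝ) (2 * Real.pi), circleMap 0 r θ = z := by
  refine ⟨toIcoMod Real.two_pi_pos 0 z.arg, ?_, ?_⟩
  · simpa using toIcoMod_mem_Ico Real.two_pi_pos 0 z.arg
  · have : circleMap 0 r (toIcoMod Real.two_pi_pos 0 z.arg) = circleMap 0 r z.arg := by
      rw [toIcoMod]
      exact (periodic_circleMap 0 r).sub_zsmul_eq _
    rw [this, circleMap, zero_add, ← hz, Complex.norm_mul_exp_arg_mul_I]

theorem enorm_le_integralMean_top {f : 𝔻 → ℂ} (hf : IsAnalyticOnDisc f) {R : ℝ}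
    (hR : R ∈ Ioo (0 : ℝ) 1) {w : ℂ} (hw : w ∈ ball 0 R) :
    ‖discExtend f w‖ₑ ≤ integralMean ∞ f R := by
  have hd : DiffContOnCl ℂ (discExtend f) (ball 0 R) :=
    ((hf.analyticOnNhd hR.2).differentiableOn.mono closure_ball_subset_closedBall).diffContOnCl
  obtain ⟨z, hz, hmax⟩ := Complex.exists_mem_frontier_isMaxOn_norm isBounded_ball
    ⟨w, hw⟩ hd
  rw [frontier_ball 0 hR.1.ne', mem_sphere_zero_iff_norm] at hz
  obtain ⟨θ, hθ, rfl⟩ := exists_circleMap_eq hz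
  have h1 : ‖discExtend f w‖ ≤ ‖discExtend f (circleMap 0 R θ)‖ := hmax (subset_closure hw)
  calc ‖discExtend f w‖ₑ ≤ circleAbs f R θ := by
        rw [circleAbs_eq]
        exact enorm_le_iff_norm_le.2 h1
    _ ≤ _ := by
        rw [integralMean, if_pos rfl]
        exact le_iSup₂ (f := fun θ _ => circleAbs f R θ) θ hθ

/-- Schwarz–Pick holds with `(1 - a)/4`; halving it to `(1 - a)/8` puts the image in the open disc
of radius `R`, as Littlewood's inequality requires. Moreover `R - |ψ(0)| ≥ (1 - a)/2`, so the
constant does not depend on `r`. For `p = ∞` the maximum principle suffices. -/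
theorem exists_integralMean_comp_le {p : ℝ≥0∞} (hp : 0 < p) {a : ℝ} (ha0 : 0 ≤ a) (ha : a < 1) :
    ∃ C : ℝ≥0∞, C ≠ ∞ ∧ ∀ ψ : 𝔻 → 𝔻, (IsAnalyticOnDisc fun z => (ψ z : ℂ)) → ‖(ψ 0 : ℂ)‖ ≤ a →
      ∀ f : 𝔻 → ℂ, IsAnalyticOnDisc f → ∀ r ∈ Ioo (0 : ℝ) 1,
        integralMean p (f ∘ ψ) r ≤ C * integralMean p f (1 - (1 - a) / 8 * (1 - r)) := by
  refine ⟨if p = ∞ then 1 else ENNReal.ofReal (4 / (1 - a)) ^ (1 / p.toReal), ?_, ?_⟩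
  · split_ifs
    · exact ENNReal.one_ne_top
    · exact ENNReal.rpow_ne_top_of_nonneg (by positivity) ENNReal.ofReal_ne_top
  intro ψ hψ hψ0 f hf r hr
  obtain ⟨hr0, hr1⟩ := hr
  set R := 1 - (1 - a) / 8 * (1 - r) with hRdef
  set Φ := discExtend fun w => (ψ w : ℂ) with hΦdef
  have hΦ0 : ‖Φ 0‖ ≤ a := by
    rw [hΦdef, ← Complex.UnitDisc.coe_zero, discExtend_coe]
    exact hψ0
  have hRmem : R ∈ Ioo (0 : ℝ) 1 := by constructor <;> nlinarith
  have hmaps : MapsTo Φ (closedBall 0 r) (ball 0 R) := fun z hz => by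
    have hzr : ‖z‖ ≤ r := by simpa using hz
    have h := mul_one_sub_norm_le_one_sub_norm hψ (mapsTo_discExtend ψ)
      (closedBall_subset_ball hr1 hz)
    have h1 : (1 - a) / 4 * (1 - r) ≤ (1 - ‖Φ 0‖) / 4 * (1 - ‖z‖) := by
      have : 0 ≤ 1 - ‖Φ 0‖ := by linarith
      gcongr
    rw [mem_ball_zero_iff]
    nlinarith
  by_cases hp' : p = ∞
  · rw [if_pos hp', one_mul, hp']
    conv_lhs => rw [integralMean, if_pos rfl]
    refine iSup₂_le fun θ _ => ?_
    rw [circleAbs_eq, discExtend_comp f ψ (circleMap_mem_ball_one ⟨hr0, hr1⟩ θ)]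
    exact enorm_le_integralMean_top hf hRmem
      (hmaps (circleMap_mem_closedBall 0 hr0.le θ))
  · rw [if_neg hp']
    have hs : 0 < p.toReal := ENNReal.toReal_pos hp.ne' hp'
    rw [integralMean_eq_circleAverage hp hp' (hf.comp hψ) ⟨hr0, hr1⟩,
      integralMean_eq_circleAverage hp hp' hf hRmem,
      ← ENNReal.mul_rpow_of_nonneg _ _ (by positivity),
      ← ENNReal.ofReal_mul (div_nonneg (by norm_num) (by linarith))]
    refine ENNReal.rpow_le_rpow (ENNReal.ofReal_le_ofReal ?_) (by positivity)
    have hL := circleAverage_rpow_norm_comp_le hs hr0 (hf.analyticOnNhd hRmem.2)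
      (hψ.analyticOnNhd hr1) hmaps
    have hcongr : Real.circleAverage (fun z => ‖discExtend (f ∘ ψ) z‖ ^ p.toReal) 0 r =
        Real.circleAverage (fun z => ‖discExtend f (Φ z)‖ ^ p.toReal) 0 r :=
      Real.circleAverage_congr_sphere fun z hz => by
        rw [abs_of_pos hr0] at hz
        simp only [discExtend_comp f ψ
          (closedBall_subset_ball hr1 (sphere_subset_closedBall hz)), Φ]
    rw [hcongr]
    refine hL.trans (mul_le_mul_of_nonneg_right ?_
      (Real.circleAverage_nonneg_of_nonneg fun _ _ => by positivity))
    have h1 : (1 - a) / 2 ≤ R - ‖Φ 0‖ := by nlinarith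
    calc (R + ‖Φ 0‖) / (R - ‖Φ 0‖) ≤ 2 / ((1 - a) / 2) :=
          div_le_div₀ (by norm_num) (by linarith [hRmem.2]) (by linarith) h1
      _ = 4 / (1 - a) := by
          have : 1 - a ≠ 0 := by linarith
          field_simp
          norm_num

/-- Here, unlike in `exists_integralMean_add_le`, the constant is chosen before the functions;
dominated convergence needs this for the family `f ∘ φ_t`. -/
theorem exists_integralMean_sub_le (p : ℝ≥0∞) :
    ∃ C : ℝ≥0∞, C ≠ ∞ ∧ ∀ f g : 𝔻 → ℂ, IsAnalyticOnDisc f → ∀ r,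
      integralMean p (f - g) r ≤ C * (integralMean p f r + integralMean p g r) := by
  have hsub : ∀ (f g : 𝔻 → ℂ) (r θ : ℝ),
      circleAbs (f - g) r θ ≤ circleAbs f r θ + circleAbs g r θ := fun f g r θ => by
    have h1 : f - g = f + (-1 : ℂ) • g := by simp [sub_eq_add_neg]
    unfold circleAbs
    rw [h1, discExtend_add, discExtend_smul]
    refine (enorm_add_le _ _).trans_eq ?_
    simp
  by_cases hp : p = ∞
  · refine ⟨1, by simp, fun f g hf r => ?_⟩
    simp only [integralMean, hp, if_true, one_mul]
    refine iSup₂_le fun θ hθ => (hsub f g r θ).trans ?_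
    exact add_le_add (le_iSup₂ (f := fun θ _ => circleAbs f r θ) θ hθ)
      (le_iSup₂ (f := fun θ _ => circleAbs g r θ) θ hθ)
  · obtain ⟨C, hC, h⟩ := exists_rpow_add_le (s := p.toReal) ENNReal.toReal_nonneg
    have hs : 0 ≤ 1 / p.toReal := by positivity
    obtain ⟨D, hD, h'⟩ := exists_rpow_add_le hs
    refine ⟨C ^ (1 / p.toReal) * D, ENNReal.mul_ne_top (ENNReal.rpow_ne_top_of_nonneg hs hC) hD,
      fun f g hf r => ?_⟩
    simp only [integralMean, hp, if_false]
    have hm : Measurable fun θ => circleAbs f r θ ^ p.toReal :=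
      ((measurable_circleAbs hf).comp measurable_prodMk_left).pow_const _
    rw [mul_assoc]
    refine le_trans ?_ (mul_le_mul_right (h' _ _) _)
    rw [← ENNReal.mul_rpow_of_nonneg _ _ hs]
    refine ENNReal.rpow_le_rpow ?_ hs
    rw [← ENNReal.add_div, ← mul_div_assoc]
    gcongr
    rw [← lintegral_add_left hm, ← lintegral_const_mul' _ _ hC]
    refine lintegral_mono fun θ => ?_
    exact (ENNReal.rpow_le_rpow (hsub f g r θ) ENNReal.toReal_nonneg).trans (h _ _)

theorem integralMean_le_of_forall_le {p : ℝ≥0∞} (hp : 0 < p) {f : 𝔻 → ℂ} {r : ℝ} {c : ℝ≥0∞}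
    (h : ∀ θ, circleAbs f r θ ≤ c) : integralMean p f r ≤ c := by
  unfold integralMean
  split_ifs with hp'
  · exact iSup₂_le fun θ _ => h θ
  · have hs : 0 < p.toReal := ENNReal.toReal_pos hp.ne' hp'
    calc _ ≤ ((∫⁻ _ in Ico (0 : ℝ) (2 * Real.pi), c ^ p.toReal) /
          ENNReal.ofReal (2 * Real.pi)) ^ (1 / p.toReal) := by
          gcongr with θ
          exact h θ
      _ = c := by
          rw [setLIntegral_const, Real.volume_Ico, sub_zero, ENNReal.mul_div_cancel_right
            (by simpa using Real.pi_pos) ENNReal.ofReal_ne_top, ← ENNReal.rpow_mul,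
            mul_one_div_cancel hs.ne', ENNReal.rpow_one]

theorem integralMean_mono {p : ℝ≥0∞} {f g : 𝔻 → ℂ} {r : ℝ}
    (h : ∀ θ, circleAbs f r θ ≤ circleAbs g r θ) : integralMean p f r ≤ integralMean p g r := by
  unfold integralMean
  split_ifs with hp'
  · exact iSup₂_mono fun θ _ => h θ
  · gcongr with θ
    exact h θ

theorem integralMean_one {p : ℝ≥0∞} (hp : 0 < p) {r : ℝ} (hr : r ∈ Ioo (0 : ℝ) 1) :
    integralMean p 1 r = 1 := by
  have h : ∀ θ, circleAbs 1 r θ = 1 := fun θ => by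
    rw [circleAbs_eq, discExtend_of_mem_ball _ (circleMap_mem_ball_one hr θ)]
    simp
  refine le_antisymm (integralMean_le_of_forall_le hp fun θ => (h θ).le) ?_
  unfold integralMean
  split_ifs with hp'
  · exact (h 0).ge.trans (le_iSup₂ (f := fun θ _ => circleAbs 1 r θ) 0 ⟨le_rfl, Real.two_pi_pos⟩)
  · simp only [h, ENNReal.one_rpow]
    rw [setLIntegral_const, Real.volume_Ico, sub_zero, one_mul, ENNReal.div_self
      (by simpa using Real.pi_pos) ENNReal.ofReal_ne_top, ENNReal.one_rpow]

/-! ### Composition operators in the mixed norm. -/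

/-- Under `s = 1 - k * (1 - r)` the weight scales by `k ^ (β - 1)` and the Jacobian is `k`. The only
loss is in enlarging the image interval to all of `(0, 1)`. -/
theorem lintegral_weight_mul_comp_le {k : ℝ} (hk : k ∈ Ioo (0 : ℝ) 1) (β : ℝ) (M : ℝ → ℝ≥0∞) :
    ∫⁻ r in Ioo (0 : ℝ) 1, ENNReal.ofReal ((1 - r) ^ (β - 1)) * M (1 - k * (1 - r)) ≤
      ENNReal.ofReal (k ^ (-β)) *
        ∫⁻ r in Ioo (0 : ℝ) 1, ENNReal.ofReal ((1 - r) ^ (β - 1)) * M r := by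
  obtain ⟨hk0, hk1⟩ := hk
  have hinj : InjOn (fun r : ℝ => 1 - k * (1 - r)) (Ioo 0 1) := fun x _ y _ h => by
    have : k * (1 - x) = k * (1 - y) := by simpa using h
    linarith [mul_left_cancel₀ hk0.ne' this]
  have hderiv : ∀ x ∈ Ioo (0 : ℝ) 1,
      HasDerivWithinAt (fun r : ℝ => 1 - k * (1 - r)) k (Ioo 0 1) x := fun x _ => by
    have := (((hasDerivAt_id x).const_sub 1).const_mul k).const_sub 1
    simpa using this.hasDerivWithinAt
  have himage : (fun r : ℝ => 1 - k * (1 - r)) '' Ioo 0 1 ⊆ Ioo 0 1 := by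
    rintro _ ⟨x, ⟨hx0, hx1⟩, rfl⟩
    constructor <;> nlinarith
  have hcv := lintegral_image_eq_lintegral_abs_deriv_mul measurableSet_Ioo hderiv hinj
    fun r => ENNReal.ofReal ((1 - r) ^ (β - 1)) * M r
  calc ∫⁻ r in Ioo (0 : ℝ) 1, ENNReal.ofReal ((1 - r) ^ (β - 1)) * M (1 - k * (1 - r))
      = ∫⁻ r in Ioo (0 : ℝ) 1, ENNReal.ofReal (k ^ (-β)) * (ENNReal.ofReal |k| *
          (ENNReal.ofReal ((1 - (1 - k * (1 - r))) ^ (β - 1)) * M (1 - k * (1 - r)))) := by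
        refine setLIntegral_congr_fun measurableSet_Ioo fun r hr => ?_
        have h1 : (0 : ℝ) ≤ 1 - r := by linarith [hr.2]
        simp only [← mul_assoc]
        rw [← ENNReal.ofReal_mul (by positivity), ← ENNReal.ofReal_mul (by positivity)]
        congr 2
        rw [abs_of_pos hk0, sub_sub_cancel, Real.mul_rpow hk0.le h1, ← mul_assoc, mul_assoc _ k]
        nth_rw 2 [← Real.rpow_one k]
        rw [← Real.rpow_add hk0, ← Real.rpow_add hk0]
        simp
    _ = ENNReal.ofReal (k ^ (-β)) * ∫⁻ r in (fun r : ℝ => 1 - k * (1 - r)) '' Ioo 0 1,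
          ENNReal.ofReal ((1 - r) ^ (β - 1)) * M r := by
        rw [lintegral_const_mul' _ _ ENNReal.ofReal_ne_top, hcv]
    _ ≤ _ := by
        gcongr

theorem mixedNorm_le_mul {p : ℝ≥0∞} {q α : ℝ} (hq : 0 < q) {f g : 𝔻 → ℂ} {C : ℝ≥0∞}
    (h : ∫⁻ r in Ioo (0 : ℝ) 1, ENNReal.ofReal ((1 - r) ^ (α * q - 1)) * integralMean p f r ^ q ≤
      C * ∫⁻ r in Ioo (0 : ℝ) 1,
        ENNReal.ofReal ((1 - r) ^ (α * q - 1)) * integralMean p g r ^ q) :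
    mixedNorm p q α f ≤ C ^ (1 / q) * mixedNorm p q α g := by
  have hq' : 0 ≤ 1 / q := by positivity
  unfold mixedNorm
  rw [← ENNReal.mul_rpow_of_nonneg _ _ hq', mul_left_comm]
  gcongr

theorem exists_mixedNorm_comp_le {p : ℝ≥0∞} (hp : 0 < p) {q : ℝ} (hq : 0 < q) (α : ℝ)
    {a : ℝ} (ha0 : 0 ≤ a) (ha : a < 1) :
    ∃ B : ℝ≥0∞, B ≠ ∞ ∧ ∀ ψ : 𝔻 → 𝔻, (IsAnalyticOnDisc fun z => (ψ z : ℂ)) → ‖(ψ 0 : ℂ)‖ ≤ a →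
      ∀ f : 𝔻 → ℂ, IsAnalyticOnDisc f → mixedNorm p q α (f ∘ ψ) ≤ B * mixedNorm p q α f := by
  obtain ⟨C, hC, h⟩ := exists_integralMean_comp_le hp ha0 ha
  have hk : (1 - a) / 8 ∈ Ioo (0 : ℝ) 1 := by constructor <;> linarith
  have hCq : C ^ q ≠ ∞ := ENNReal.rpow_ne_top_of_nonneg hq.le hC
  refine ⟨(C ^ q * ENNReal.ofReal (((1 - a) / 8) ^ (-(α * q)))) ^ (1 / q),
    ENNReal.rpow_ne_top_of_nonneg (by positivity) (ENNReal.mul_ne_top hCq ENNReal.ofReal_ne_top),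
    fun ψ hψ hψ0 f hf => mixedNorm_le_mul hq ?_⟩
  calc ∫⁻ r in Ioo (0 : ℝ) 1,
        ENNReal.ofReal ((1 - r) ^ (α * q - 1)) * integralMean p (f ∘ ψ) r ^ q
      ≤ ∫⁻ r in Ioo (0 : ℝ) 1, C ^ q * (ENNReal.ofReal ((1 - r) ^ (α * q - 1)) *
          integralMean p f (1 - (1 - a) / 8 * (1 - r)) ^ q) := by
        refine setLIntegral_mono' measurableSet_Ioo fun r hr => ?_
        rw [mul_left_comm, ← ENNReal.mul_rpow_of_nonneg _ _ hq.le]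
        gcongr
        exact h ψ hψ hψ0 f hf r hr
    _ ≤ _ := by
        rw [lintegral_const_mul' _ _ hCq, mul_assoc]
        gcongr
        exact lintegral_weight_mul_comp_le hk (α * q) fun r => integralMean p f r ^ q

theorem mixedNorm_mono {p : ℝ≥0∞} {q : ℝ} (hq : 0 < q) (α : ℝ) {f g : 𝔻 → ℂ}
    (h : ∀ z, ‖f z‖ ≤ ‖g z‖) : mixedNorm p q α f ≤ mixedNorm p q α g := by
  have hM : ∀ r, integralMean p f r ≤ integralMean p g r := fun r =>
    integralMean_mono fun θ => by
      rw [circleAbs_eq, circleAbs_eq]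
      by_cases hz : circleMap 0 r θ ∈ ball (0 : ℂ) 1
      · rw [discExtend_of_mem_ball _ hz, discExtend_of_mem_ball _ hz]
        exact enorm_le_iff_norm_le.2 (h _)
      · rw [discExtend_of_one_le f (by simpa using hz)]
        simp
  unfold mixedNorm
  gcongr with r
  exact hM r

theorem mixedNorm_one {p : ℝ≥0∞} (hp : 0 < p) {q α : ℝ} (hq : 0 < q) (hα : 0 < α) :
    mixedNorm p q α 1 = 1 := by
  have hβ : 0 < α * q := mul_pos hα hq
  have hint : IntervalIntegrable (fun r : ℝ => (1 - r) ^ (α * q - 1)) volume 0 1 := by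
    have := (intervalIntegral.intervalIntegrable_rpow' (a := 0) (b := 1)
      (by linarith : -1 < α * q - 1)).comp_sub_left 1
    simpa using this.symm
  have hval : ∫ r in (0 : ℝ)..1, (1 - r) ^ (α * q - 1) = 1 / (α * q) := by
    rw [intervalIntegral.integral_comp_sub_left (fun r : ℝ => r ^ (α * q - 1)) 1, sub_self,
      sub_zero, integral_rpow (Or.inl (by linarith))]
    simp [Real.zero_rpow hβ.ne']
  have hI : ∫⁻ r in Ioo (0 : ℝ) 1, ENNReal.ofReal ((1 - r) ^ (α * q - 1)) =
      ENNReal.ofReal (1 / (α * q)) := by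
    rw [← hval, intervalIntegral.integral_of_le zero_le_one, ofReal_integral_eq_lintegral_ofReal
      ((intervalIntegrable_iff_integrableOn_Ioc_of_le zero_le_one).1 hint),
      Measure.restrict_congr_set Ioo_ae_eq_Ioc]
    refine (ae_restrict_iff' measurableSet_Ioc).2 (Eventually.of_forall fun r hr => ?_)
    exact Real.rpow_nonneg (by linarith [hr.2]) _
  unfold mixedNorm
  have : ∫⁻ r in Ioo (0 : ℝ) 1, ENNReal.ofReal ((1 - r) ^ (α * q - 1)) * integralMean p 1 r ^ q =
      ∫⁻ r in Ioo (0 : ℝ) 1, ENNReal.ofReal ((1 - r) ^ (α * q - 1)) :=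
    setLIntegral_congr_fun measurableSet_Ioo fun r hr => by
      simp only [integralMean_one hp hr, ENNReal.one_rpow, mul_one]
  rw [this, hI, ← ENNReal.ofReal_mul hβ.le, mul_one_div_cancel hβ.ne', ENNReal.ofReal_one,
    ENNReal.one_rpow]

/-! ### Strong continuity. -/

theorem isCompact_setOf_norm_eq {r : ℝ} (hr : r < 1) : IsCompact {z : 𝔻 | ‖(z : ℂ)‖ = r} := by
  rw [Complex.UnitDisc.isEmbedding_coe.isInducing.isCompact_iff]
  convert isCompact_sphere (0 : ℂ) r
  ext z
  simp only [mem_image, mem_ofPred_eq, mem_sphere_iff_norm, sub_zero]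
  constructor
  · rintro ⟨w, hw, rfl⟩
    exact hw
  · intro hz
    exact ⟨Complex.UnitDisc.mk z (hz ▸ hr), hz, rfl⟩

theorem tendsto_integralMean_comp_sub {p : ℝ≥0∞} (hp : 0 < p) {φ : ℝ≥0 → 𝔻 → 𝔻}
    (hφ : IsAnalyticSemigroup φ) {f : 𝔻 → ℂ} (hf : IsAnalyticOnDisc f) {r : ℝ}
    (hr : r ∈ Ioo (0 : ℝ) 1) :
    Tendsto (fun t => integralMean p (f ∘ φ t - f) r) (𝓝[>] 0) (𝓝 0) := by
  rw [ENNReal.tendsto_nhds_zero]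
  intro ε hε
  by_cases hε' : ε = ∞
  · simp [hε']
  have hεr : 0 < ε.toReal := ENNReal.toReal_pos hε.ne' hε'
  obtain ⟨hr0, hr1⟩ := hr
  -- A radius strictly between `r` and `1`: for small `t` the circle of radius `r` is mapped into
  -- the closed disc of radius `ρ`, where `f` is uniformly continuous.
  set ρ := (1 + r) / 2 with hρ
  have huc := (isCompact_closedBall (0 : ℂ) ρ).uniformContinuousOn_of_continuous
    (hf.analyticOnNhd (by linarith : ρ < 1)).continuousOn
  rw [Metric.uniformContinuousOn_iff] at huc
  obtain ⟨δ, hδ, hδ'⟩ := huc _ hεr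
  have hunif := Metric.tendstoUniformlyOn_iff.1 (hφ.tendsto _ (isCompact_setOf_norm_eq hr1))
    (min δ (ρ - r)) (lt_min hδ (by linarith))
  filter_upwards [hunif] with t ht
  refine integralMean_le_of_forall_le hp fun θ => ?_
  have hz := circleMap_mem_ball_one ⟨hr0, hr1⟩ θ
  have hznorm : ‖circleMap 0 r θ‖ = r := by simp [abs_of_pos hr0]
  rw [circleAbs_eq, discExtend_of_mem_ball _ hz]
  set z : 𝔻 := Complex.UnitDisc.mk (circleMap 0 r θ) (by simpa using hz)
  have hzr : ‖(z : ℂ)‖ = r := hznorm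
  have hd := ht z hzr
  rw [hφ.zero, id_eq, lt_min_iff] at hd
  have hzρ : (z : ℂ) ∈ closedBall (0 : ℂ) ρ := by
    rw [mem_closedBall_zero_iff, hzr]
    linarith
  have hwρ : (φ t z : ℂ) ∈ closedBall (0 : ℂ) ρ := by
    rw [mem_closedBall_zero_iff]
    have h2 := hd.2
    rw [dist_eq_norm'] at h2
    linarith [norm_le_norm_add_norm_sub' (φ t z : ℂ) (z : ℂ)]
  have h3 := (hδ' _ hwρ _ hzρ (by rw [dist_comm]; exact hd.1)).le
  rw [discExtend_coe, discExtend_coe, dist_eq_norm] at h3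
  rw [← ofReal_norm, ← ENNReal.ofReal_toReal hε']
  exact ENNReal.ofReal_le_ofReal h3

theorem tendsto_mixedNorm_comp_sub {p : ℝ≥0∞} (hp : 0 < p) {q : ℝ} (hq : 0 < q) (α : ℝ)
    (hα : 0 < α) {φ : ℝ≥0 → 𝔻 → 𝔻} (hφ : IsAnalyticSemigroup φ) {f : 𝔻 → ℂ}
    (hf : IsAnalyticOnDisc f) (hfn : mixedNorm p q α f < ∞) :
    Tendsto (fun t => mixedNorm p q α (f ∘ φ t - f)) (𝓝[>] 0) (𝓝 0) := by
  -- Any bound in `(0, 1)` would do: `φ_t(0) → 0`, so `|φ_t(0)| ≤ 1/2` eventually.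
  obtain ⟨C, hC, hcomp⟩ := exists_integralMean_comp_le hp (a := 1 / 2) (by norm_num) (by norm_num)
  obtain ⟨D, hD, hsub⟩ := exists_integralMean_sub_le p
  obtain ⟨E, hE, hadd⟩ := exists_rpow_add_le hq.le
  set k : ℝ := (1 - 1 / 2) / 8 with hk
  have hk' : k ∈ Ioo (0 : ℝ) 1 := by constructor <;> norm_num [hk]
  set w : ℝ → ℝ≥0∞ := fun r => ENNReal.ofReal ((1 - r) ^ (α * q - 1)) with hw
  have hwm : Measurable w := by fun_prop
  have hIf : ∫⁻ r in Ioo (0 : ℝ) 1, w r * integralMean p f r ^ q ≠ ∞ := by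
    rw [mixedNorm_lt_top_iff p hq] at hfn
    intro h
    rw [h, ENNReal.mul_top (by simpa using mul_pos hα hq)] at hfn
    exact absurd hfn (lt_irrefl _)
  have hsmall : ∀ᶠ t in 𝓝[>] (0 : ℝ≥0), ‖(φ t 0 : ℂ)‖ ≤ 1 / 2 := by
    have := Metric.tendstoUniformlyOn_iff.1 (hφ.tendsto {0} isCompact_singleton) (1 / 2)
      (by norm_num)
    filter_upwards [this] with t ht
    have h := ht 0 rfl
    rw [hφ.zero, id_eq, Complex.UnitDisc.coe_zero, dist_zero_left] at h
    exact h.le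
  have hCq : C ^ q ≠ ∞ := ENNReal.rpow_ne_top_of_nonneg hq.le hC
  have hDE : D ^ q * E ≠ ∞ := ENNReal.mul_ne_top (ENNReal.rpow_ne_top_of_nonneg hq.le hD) hE
  have hlim : Tendsto (fun t => ∫⁻ r in Ioo (0 : ℝ) 1, w r * integralMean p (f ∘ φ t - f) r ^ q)
      (𝓝[>] 0) (𝓝 (∫⁻ _ in Ioo (0 : ℝ) 1, 0)) := by
    refine tendsto_lintegral_filter_of_dominated_convergence
      (fun r => D ^ q * E * (C ^ q * (w r * integralMean p f (1 - k * (1 - r)) ^ q) +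
        w r * integralMean p f r ^ q)) ?_ ?_ ?_ ?_
    · exact Eventually.of_forall fun t => hwm.mul
        ((measurable_integralMean p ((hf.comp (hφ.analytic t)).sub hf)).pow_const q)
    · filter_upwards [hsmall] with t ht
      refine (ae_restrict_iff' measurableSet_Ioo).2 (Eventually.of_forall fun r hr => ?_)
      calc w r * integralMean p (f ∘ φ t - f) r ^ q
          ≤ w r * (D * (C * integralMean p f (1 - k * (1 - r)) + integralMean p f r)) ^ q := by
            gcongr
            refine (hsub _ _ (hf.comp (hφ.analytic t)) r).trans ?_
            gcongr
            exact hcomp _ (hφ.analytic t) ht f hf r hr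
        _ ≤ w r * (D ^ q * (E * ((C * integralMean p f (1 - k * (1 - r))) ^ q +
              integralMean p f r ^ q))) := by
            rw [ENNReal.mul_rpow_of_nonneg _ _ hq.le]
            gcongr
            exact hadd _ _
        _ = _ := by
            rw [ENNReal.mul_rpow_of_nonneg _ _ hq.le]
            ring
    · have hm : Measurable fun r => C ^ q * (w r * integralMean p f (1 - k * (1 - r)) ^ q) :=
        (hwm.mul (((measurable_integralMean p hf).comp (by fun_prop)).pow_const q)).const_mul _
      rw [lintegral_const_mul' _ _ hDE, lintegral_add_left hm, lintegral_const_mul' _ _ hCq]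
      refine ENNReal.mul_ne_top hDE (ENNReal.add_ne_top.2 ⟨ENNReal.mul_ne_top hCq ?_, hIf⟩)
      exact ((lintegral_weight_mul_comp_le hk' (α * q) fun r => integralMean p f r ^ q).trans_lt
        (ENNReal.mul_lt_top ENNReal.ofReal_lt_top hIf.lt_top)).ne
    · refine (ae_restrict_iff' measurableSet_Ioo).2 (Eventually.of_forall fun r hr => ?_)
      have h1 := ((ENNReal.continuous_rpow_const (y := q)).tendsto 0).comp
        (tendsto_integralMean_comp_sub hp hφ hf hr)
      rw [ENNReal.zero_rpow_of_pos hq] at h1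
      simpa using ENNReal.Tendsto.const_mul h1 (Or.inr (ENNReal.ofReal_ne_top :
        ENNReal.ofReal ((1 - r) ^ (α * q - 1)) ≠ ∞))
  rw [lintegral_zero] at hlim
  have h2 := ENNReal.Tendsto.const_mul hlim
    (Or.inr (ENNReal.ofReal_ne_top : ENNReal.ofReal (α * q) ≠ ∞))
  rw [mul_zero] at h2
  have h3 := ((ENNReal.continuous_rpow_const (y := 1 / q)).tendsto 0).comp h2
  rw [ENNReal.zero_rpow_of_pos (by positivity)] at h3
  exact h3

/-! ### The lower bound `1/8` for a nontrivial self-map. -/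

/-- The maximum principle for `ψ(z) - z` on discs of radius close to `1`, with `δ` its modulus at a
point that `ψ` moves. -/
theorem exists_displacement_le_near_boundary {ψ : 𝔻 → 𝔻}
    (hψ : IsAnalyticOnDisc fun z => (ψ z : ℂ)) (hne : ψ ≠ id) :
    ∃ δ > 0, ∀ r₀ < 1, ∃ a : 𝔻, r₀ < ‖(a : ℂ)‖ ∧ δ ≤ ‖(ψ a : ℂ) - a‖ := by
  obtain ⟨z₀, hz₀⟩ := Function.ne_iff.1 hne
  refine ⟨‖(ψ z₀ : ℂ) - z₀‖, norm_pos_iff.2 (sub_ne_zero.2 fun h => hz₀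
    (Complex.UnitDisc.coe_injective h)), fun r₀ hr₀ => ?_⟩
  obtain ⟨R, hR, hR1⟩ := exists_between (max_lt hr₀ z₀.norm_lt_one)
  rw [max_lt_iff] at hR
  have hd : DiffContOnCl ℂ (fun z => discExtend (fun w => (ψ w : ℂ)) z - z) (ball 0 R) :=
    ((((hψ.analyticOnNhd hR1).differentiableOn).sub differentiableOn_id).mono
      closure_ball_subset_closedBall).diffContOnCl
  have hz₀R : (z₀ : ℂ) ∈ ball (0 : ℂ) R := by simpa using hR.2
  obtain ⟨z, hz, hmax⟩ := Complex.exists_mem_frontier_isMaxOn_norm isBounded_ball ⟨_, hz₀R⟩ hd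
  rw [frontier_ball 0 (pos_of_mem_ball hz₀R).ne', mem_sphere_zero_iff_norm] at hz
  lift z to 𝔻 using hz ▸ hR1
  have h : ‖discExtend (fun w => (ψ w : ℂ)) z₀ - z₀‖ ≤
    ‖discExtend (fun w => (ψ w : ℂ)) z - z‖ := hmax (subset_closure hz₀R)
  rw [discExtend_coe, discExtend_coe] at h
  exact ⟨z, hz ▸ hR.1, h⟩

/-- The norm of the evaluation functional at `a`. -/
def evaluationNorm (p : ℝ≥0∞) (q α : ℝ) (a : 𝔻) : ℝ≥0∞ :=
  ⨆ (g : 𝔻 → ℂ) (_ : IsAnalyticOnDisc g ∧ mixedNorm p q α g ≤ 1), ‖g a‖ₑ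

theorem IsAnalyticOnDisc.const_smul {f : 𝔻 → ℂ} (hf : IsAnalyticOnDisc f) (c : ℂ) :
    IsAnalyticOnDisc (c • f) := by
  unfold IsAnalyticOnDisc
  rw [discExtend_smul]
  exact DifferentiableOn.const_smul hf c

theorem isAnalyticOnDisc_one : IsAnalyticOnDisc 1 :=
  isAnalyticOnDisc_of_differentiable (differentiable_const 1)

theorem enorm_apply_le_mul_evaluationNorm {p : ℝ≥0∞} (hp : 0 < p) {q : ℝ} (hq : 0 < q) (α : ℝ)
    {g : 𝔻 → ℂ} (hg : IsAnalyticOnDisc g) {s : ℝ≥0} (hs : 0 < s) (hgs : mixedNorm p q α g ≤ s)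
    (a : 𝔻) : ‖g a‖ₑ ≤ s * evaluationNorm p q α a := by
  have hs' : (s : ℂ) ≠ 0 := by exact_mod_cast hs.ne'
  have henorm : ‖(s : ℂ)‖ₑ = s := by
    rw [← ofReal_norm]
    simp
  have hinv : ‖(s : ℂ)⁻¹‖ₑ * s = 1 := by
    rw [← henorm, ← enorm_mul, inv_mul_cancel₀ hs', enorm_one]
  have h1 : ‖((s : ℂ)⁻¹ • g) a‖ₑ ≤ evaluationNorm p q α a := by
    refine le_iSup₂_of_le ((s : ℂ)⁻¹ • g) ⟨hg.const_smul _, ?_⟩ le_rfl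
    rw [mixedNorm_smul hp hq, ← hinv]
    gcongr
  calc ‖g a‖ₑ = s * ‖((s : ℂ)⁻¹ • g) a‖ₑ := by
        rw [← henorm, ← enorm_mul, Pi.smul_apply, smul_eq_mul, mul_inv_cancel_left₀ hs']
    _ ≤ _ := by gcongr

/-- Evaluation at `a` is composition with the constant self-map `a`, so the composition bound
already contains the point-evaluation estimate. -/
theorem evaluationNorm_ne_top {p : ℝ≥0∞} (hp : 0 < p) {q α : ℝ} (hq : 0 < q) (hα : 0 < α)
    (a : 𝔻) : evaluationNorm p q α a ≠ ∞ := by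
  obtain ⟨B, hB, h⟩ := exists_mixedNorm_comp_le hp hq α (norm_nonneg (a : ℂ)) a.norm_lt_one
  refine ne_top_of_le_ne_top hB (iSup₂_le fun g hg => ?_)
  have hconst : g ∘ (fun _ : 𝔻 => a) = g a • (1 : 𝔻 → ℂ) := by
    funext z
    simp
  have h1 := h (fun _ => a) (isAnalyticOnDisc_of_differentiable (differentiable_const (a : ℂ)))
    le_rfl g hg.1
  rw [hconst, mixedNorm_smul hp hq, mixedNorm_one hp hq hα, mul_one] at h1
  exact h1.trans (mul_le_of_le_one_right' hg.2)

theorem one_le_evaluationNorm {p : ℝ≥0∞} (hp : 0 < p) {q α : ℝ} (hq : 0 < q) (hα : 0 < α)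
    (a : 𝔻) : 1 ≤ evaluationNorm p q α a :=
  le_iSup₂_of_le 1 ⟨isAnalyticOnDisc_one, (mixedNorm_one hp hq hα).le⟩ (by simp)

/-- The parallelogram law for `1` and `conj ζ * w`, whose difference has modulus `|w - ζ|`. Powers
of this function peak at `ζ`. -/
theorem norm_one_add_conj_mul_div_two_sq_le {ζ w : ℂ} (hζ : ‖ζ‖ = 1) (hw : ‖w‖ ≤ 1) {δ : ℝ}
    (hδ : 0 ≤ δ) (h : δ ≤ ‖w - ζ‖) : ‖(1 + conj ζ * w) / 2‖ ^ 2 ≤ 1 - δ ^ 2 / 4 := by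
  have h1 := parallelogram_law_with_norm ℝ (1 : ℂ) (conj ζ * w)
  have hc : ‖conj ζ * w‖ = ‖w‖ := by simp [hζ]
  have hsub : ‖1 - conj ζ * w‖ = ‖w - ζ‖ := by
    have h2 : ζ * (1 - conj ζ * w) = ζ - w := by
      have : ζ * conj ζ = 1 := by
        rw [Complex.mul_conj, Complex.normSq_eq_norm_sq, hζ]
        simp
      linear_combination (-w) * this
    rw [norm_sub_rev w, ← h2, norm_mul, hζ, one_mul]
  rw [hc, hsub, norm_one] at h1
  rw [norm_div, Complex.norm_ofNat, div_pow]
  have h3 : δ ^ 2 ≤ ‖w - ζ‖ ^ 2 := by gcongr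
  have h4 : ‖w‖ ^ 2 ≤ 1 := pow_le_one₀ (norm_nonneg w) hw
  linarith

/-- Let `K` be the norm of evaluation at `a`. The test function is `f * h` with `|f(a)| > K/2` and
`h` a peak function, so `|(f * h)(a)| > K/4` while `|(f * h)(ψ(a))| ≤ K/8`. A norm of the difference
of at most `1/8` would bound the change at `a` by `K/8`, a contradiction. -/
theorem exists_mixedNorm_comp_sub_gt {p : ℝ≥0∞} (hp : 0 < p) {q α : ℝ} (hq : 0 < q) (hα : 0 < α)
    {ψ : 𝔻 → 𝔻} (hψ : IsAnalyticOnDisc fun z => (ψ z : ℂ)) (hne : ψ ≠ id) :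
    ∃ g : 𝔻 → ℂ, IsAnalyticOnDisc g ∧ mixedNorm p q α g ≤ 1 ∧
      ((1 / 8 : ℝ≥0) : ℝ≥0∞) < mixedNorm p q α (g ∘ ψ - g) := by
  by_contra! hcon
  obtain ⟨B, hB, hcomp⟩ :=
    exists_mixedNorm_comp_le hp hq α (norm_nonneg (ψ 0 : ℂ)) (ψ 0).norm_lt_one
  -- The maximum with `1` makes `b` positive, so that `1 / (8 * b)` is a usable threshold.
  set b : ℝ≥0 := max 1 B.toNNReal with hb
  have hb1 : 1 ≤ b := le_max_left _ _
  have hb0 : 0 < b := zero_lt_one.trans_le hb1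
  have hBb : B ≤ b := by
    rw [← ENNReal.coe_toNNReal hB]
    exact_mod_cast le_max_right _ _
  obtain ⟨δ, hδ, hdisp⟩ := exists_displacement_le_near_boundary hψ hne
  set x : ℝ := √(1 - (δ / 2) ^ 2 / 4) with hx
  have hx1 : x < 1 := by
    rw [hx, Real.sqrt_lt' one_pos]
    nlinarith
  have hbpos : (0 : ℝ) < 1 / (8 * b) := by positivity
  -- The exponent depends on `δ` and `b` only, so `a` can be chosen afterwards, close to the
  -- boundary in terms of `m`.
  obtain ⟨m, hm⟩ := exists_pow_lt_of_lt_one hbpos hx1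
  -- The three bounds on `|a|` respectively make `a ≠ 0`, keep `ψ(a)` at distance `δ / 2` from `ζ =
  -- a / |a|`, and give `|h(a)| ≥ 1/2` by Bernoulli's inequality.
  obtain ⟨a, ha, had⟩ := hdisp (max (1 / 2) (max (1 - δ / 2) (1 - 1 / (m + 1)))) (by
    have : (0 : ℝ) < 1 / (m + 1) := by positivity
    exact max_lt (by norm_num) (max_lt (by linarith) (by linarith)))
  rw [max_lt_iff, max_lt_iff] at ha
  obtain ⟨ha1, ha2, ha3⟩ := ha
  have ha0 : (a : ℂ) ≠ 0 := norm_pos_iff.1 (by linarith)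
  set ζ : ℂ := a / ‖(a : ℂ)‖ with hζdef
  have hna : (‖(a : ℂ)‖ : ℂ) ≠ 0 := by exact_mod_cast norm_ne_zero_iff.2 ha0
  have hζ : ‖ζ‖ = 1 := by
    rw [hζdef, norm_div, Complex.norm_real, norm_norm, div_self (norm_ne_zero_iff.2 ha0)]
  have hζa : conj ζ * a = (‖(a : ℂ)‖ : ℂ) := by
    rw [hζdef, map_div₀, Complex.conj_ofReal, div_mul_eq_mul_div, Complex.conj_mul', sq,
      mul_div_assoc, div_self hna, mul_one]
  have haζ : ‖(a : ℂ) - ζ‖ = 1 - ‖(a : ℂ)‖ := by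
    have h1 : (a : ℂ) = ‖(a : ℂ)‖ * ζ := by
      rw [hζdef, mul_div_cancel₀ _ hna]
    have h2 : (a : ℂ) - ζ = ((‖(a : ℂ)‖ - 1 : ℝ) : ℂ) * ζ := by
      push_cast
      linear_combination h1
    rw [h2, norm_mul, hζ, mul_one, Complex.norm_real, Real.norm_of_nonpos
      (by linarith [a.norm_lt_one])]
    ring
  set h : 𝔻 → ℂ := fun z => ((1 + conj ζ * z) / 2) ^ m with hh
  have hhan : IsAnalyticOnDisc h :=
    isAnalyticOnDisc_of_differentiable (F := fun z => ((1 + conj ζ * z) / 2) ^ m) (by fun_prop)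
  have hh1 : ∀ z, ‖h z‖ ≤ 1 := fun z => by
    rw [hh, norm_pow]
    refine pow_le_one₀ (norm_nonneg _) ?_
    have := norm_one_add_conj_mul_div_two_sq_le hζ z.norm_lt_one.le le_rfl (norm_nonneg _)
    exact (sq_le_one_iff₀ (norm_nonneg _)).1 (by simpa using this)
  have hha : 1 / 2 ≤ ‖h a‖ := by
    have hval : ‖h a‖ = ((1 + ‖(a : ℂ)‖) / 2) ^ m := by
      have h0 : (1 + (‖(a : ℂ)‖ : ℂ)) / 2 = (((1 + ‖(a : ℂ)‖) / 2 : ℝ) : ℂ) := by push_cast; rfl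
      simp only [hh, norm_pow, hζa]
      rw [h0, Complex.norm_real, Real.norm_of_nonneg (by positivity)]
    have hbern := one_add_mul_le_pow (a := -((1 - ‖(a : ℂ)‖) / 2))
      (by linarith [norm_nonneg (a : ℂ)]) m
    have h1 : (m : ℝ) * (1 - ‖(a : ℂ)‖) ≤ 1 := by
      have h2 : 1 - ‖(a : ℂ)‖ ≤ 1 / (m + 1) := by linarith
      calc (m : ℝ) * (1 - ‖(a : ℂ)‖) ≤ m * (1 / (m + 1)) := by gcongr
        _ ≤ 1 := by
          rw [mul_one_div, div_le_one (by positivity)]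
          linarith
    rw [hval, show (1 + ‖(a : ℂ)‖) / 2 = 1 + -((1 - ‖(a : ℂ)‖) / 2) by ring]
    linarith
  have hhψ : ‖h (ψ a)‖ ≤ 1 / (8 * b) := by
    have hfar : δ / 2 ≤ ‖(ψ a : ℂ) - ζ‖ := by
      have := norm_sub_le_norm_sub_add_norm_sub (ψ a : ℂ) ζ a
      rw [norm_sub_rev ζ, haζ] at this
      linarith
    rw [hh, norm_pow]
    refine le_trans ?_ hm.le
    gcongr
    exact Real.le_sqrt_of_sq_le
      (norm_one_add_conj_mul_div_two_sq_le hζ (ψ a).norm_lt_one.le (by positivity) hfar)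
  set K := evaluationNorm p q α a with hK
  have hKtop : K ≠ ∞ := evaluationNorm_ne_top hp hq hα a
  have hK1 : 1 ≤ K := one_le_evaluationNorm hp hq hα a
  have hKlt : K / 2 < K := ENNReal.half_lt_self (by positivity) hKtop
  obtain ⟨f, ⟨hf, hfn⟩, hfa⟩ : ∃ f : 𝔻 → ℂ,
      (IsAnalyticOnDisc f ∧ mixedNorm p q α f ≤ 1) ∧ K / 2 < ‖f a‖ₑ := by
    simpa only [hK, evaluationNorm, lt_iSup_iff, exists_prop] using hKlt
  have hgan := hf.mul hhan
  have hgn : mixedNorm p q α (f * h) ≤ 1 := (mixedNorm_mono hq α fun z => by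
    rw [Pi.mul_apply, norm_mul]
    exact mul_le_of_le_one_right (norm_nonneg _) (hh1 z)).trans hfn
  have hdiff : ‖((f * h) ∘ ψ - f * h) a‖ₑ ≤ ((1 / 8 : ℝ≥0) : ℝ≥0∞) * K :=
    enorm_apply_le_mul_evaluationNorm hp hq α ((hgan.comp hψ).sub hgan) (by norm_num)
      (hcon _ hgan hgn) a
  -- The value of `f` at `ψ(a)` is bounded through evaluation at `a`, using boundedness of
  -- composition, so it is measured by the same `K`.
  have hfψ : ‖(f ∘ ψ) a‖ₑ ≤ b * K :=
    enorm_apply_le_mul_evaluationNorm hp hq α (hf.comp hψ) hb0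
      (((hcomp ψ hψ le_rfl f hf).trans (mul_le_of_le_one_right' hfn)).trans hBb) a
  lift K to ℝ≥0 using hKtop with k
  have hk1 : (1 : ℝ) ≤ k := by exact_mod_cast hK1
  have toReal_le : ∀ (z : ℂ) (s : ℝ≥0), ‖z‖ₑ ≤ s * k → ‖z‖ ≤ s * k := fun z s hz => by
    rw [← ENNReal.coe_mul, enorm_le_coe] at hz
    exact_mod_cast hz
  have hdiff' := toReal_le _ _ hdiff
  have hfψ' := toReal_le _ _ hfψ
  have hfa' : (k : ℝ) / 2 < ‖f a‖ := by
    have h2 : ((k / 2 : ℝ≥0) : ℝ≥0∞) < (‖f a‖₊ : ℝ≥0∞) := by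
      rw [ENNReal.coe_div two_ne_zero]
      exact hfa
    exact_mod_cast h2
  simp only [Function.comp_apply, Pi.sub_apply, Pi.mul_apply] at hdiff' hfψ'
  have e1 : ‖f (ψ a) * h (ψ a)‖ ≤ k / 8 := by
    rw [norm_mul]
    calc ‖f (ψ a)‖ * ‖h (ψ a)‖ ≤ (b * k) * (1 / (8 * b)) := by gcongr
      _ = k / 8 := by
        have : (b : ℝ) ≠ 0 := by exact_mod_cast hb0.ne'
        field_simp
  have e2 : (k : ℝ) / 4 < ‖f a * h a‖ := by
    rw [norm_mul]
    calc (k : ℝ) / 4 = k / 2 * (1 / 2) := by ring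
      _ < ‖f a‖ * (1 / 2) := by gcongr
      _ ≤ ‖f a‖ * ‖h a‖ := by gcongr
  have e3 := norm_le_norm_add_norm_sub' (f a * h a) (f (ψ a) * h (ψ a))
  rw [norm_sub_rev] at e3
  push_cast at hdiff'
  linarith

/-! ### From single maps to the semigroup. -/

/-- `φ_t` is an iterate of `φ_{t/(n+1)}`, which is the identity once `n` is large. -/
theorem IsAnalyticSemigroup.isTrivial_of_eventually_eq_id {φ : ℝ≥0 → 𝔻 → 𝔻}
    (hφ : IsAnalyticSemigroup φ) (h : ∀ᶠ t in 𝓝[>] 0, φ t = id) : IsTrivialSemigroup φ := by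
  have hmul : ∀ (n : ℕ) (s : ℝ≥0), φ s = id → φ (n * s) = id := fun n s hs => by
    induction n with
    | zero => simpa using hφ.zero
    | succ n ih =>
      rw [Nat.cast_succ, add_mul, one_mul, hφ.add, ih, hs]
      rfl
  intro t
  rcases eq_or_ne t 0 with rfl | ht
  · exact hφ.zero
  have hlim : Tendsto (fun n : ℕ => t / (n + 1 : ℝ≥0)) atTop (𝓝[>] 0) := by
    refine tendsto_nhdsWithin_iff.2 ⟨?_, Eventually.of_forall fun n => ?_⟩
    · have h1 := (tendsto_one_div_add_atTop_nhds_zero_nat (𝕜 := ℝ≥0)).const_mul t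
      simpa [div_eq_mul_inv] using h1
    · exact div_pos (pos_iff_ne_zero.2 ht) (by positivity)
  obtain ⟨n, hn⟩ := (hlim.eventually h).exists
  have := hmul (n + 1) _ hn
  rwa [Nat.cast_succ, mul_div_cancel₀ _ (by positivity)] at this

/-- The composition operator `f ↦ f ∘ ψ` on `H(p, q, α)`. -/
def compositionOperator {p : ℝ≥0∞} {q : ℝ} (α : ℝ) (hp : 0 < p) (hq : 0 < q) (ψ : 𝔻 → 𝔻)
    (hψ : IsAnalyticOnDisc fun z => (ψ z : ℂ)) :
    mixedNormSpace p q α hp hq →ₗ[ℂ] mixedNormSpace p q α hp hq where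
  toFun f := ⟨(f : 𝔻 → ℂ) ∘ ψ, f.2.1.comp hψ, by
    obtain ⟨B, hB, h⟩ :=
      exists_mixedNorm_comp_le hp hq α (norm_nonneg (ψ 0 : ℂ)) (ψ 0).norm_lt_one
    exact (h ψ hψ le_rfl f f.2.1).trans_lt (ENNReal.mul_lt_top hB.lt_top f.2.2)⟩
  map_add' _ _ := rfl
  map_smul' _ _ := rfl

theorem operatorNorm_compositionOperator_lt_top {p : ℝ≥0∞} {q : ℝ} (α : ℝ) (hp : 0 < p)
    (hq : 0 < q) (ψ : 𝔻 → 𝔻) (hψ : IsAnalyticOnDisc fun z => (ψ z : ℂ)) :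
    operatorNorm (compositionOperator α hp hq ψ hψ) < ∞ := by
  obtain ⟨B, hB, h⟩ :=
    exists_mixedNorm_comp_le hp hq α (norm_nonneg (ψ 0 : ℂ)) (ψ 0).norm_lt_one
  refine lt_of_le_of_lt (iSup₂_le fun f hf => ?_) hB.lt_top
  exact (h ψ hψ le_rfl f f.2.1).trans (mul_le_of_le_one_right' hf)

end MixedNorm

end

theorem theorem4p2 (p : ℝ≥0∞) (q α : ℝ) (hp : 0 < p) (hq : 0 < q) (hα : 0 < α)
    (φ : ℝ≥0 → 𝔻 → 𝔻) (hφ : MixedNorm.IsAnalyticSemigroup φ) :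
    (∃ C : ℝ≥0 → MixedNorm.mixedNormSpace p q α hp hq →ₗ[ℂ] MixedNorm.mixedNormSpace p q α hp hq,
      MixedNorm.IsInducedBy C φ ∧ MixedNorm.IsOperatorSemigroup C ∧
        MixedNorm.IsStronglyContinuous C) ∧
    (¬ MixedNorm.IsTrivialSemigroup φ →
      ∀ C : ℝ≥0 → MixedNorm.mixedNormSpace p q α hp hq →ₗ[ℂ] MixedNorm.mixedNormSpace p q α hp hq,
        MixedNorm.IsInducedBy C φ → ¬ MixedNorm.IsUniformlyContinuous C) := by
  refine ⟨⟨fun t => MixedNorm.compositionOperator α hp hq (φ t) (hφ.analytic t),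
    fun _ _ => rfl, ⟨fun t => MixedNorm.operatorNorm_compositionOperator_lt_top α hp hq (φ t)
      (hφ.analytic t), ?_, ?_⟩, ?_⟩, ?_⟩
  · refine LinearMap.ext fun f => Subtype.ext ?_
    change (f : 𝔻 → ℂ) ∘ φ 0 = f
    rw [hφ.zero, Function.comp_id]
  · intro t s
    refine LinearMap.ext fun f => Subtype.ext ?_
    change (f : 𝔻 → ℂ) ∘ φ (t + s) = ((f : 𝔻 → ℂ) ∘ φ s) ∘ φ t
    -- Composition operators multiply in the opposite order to their symbols; commutativity of
    -- addition absorbs the swap.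
    rw [add_comm, hφ.add, Function.comp_assoc]
  · intro f
    exact MixedNorm.tendsto_mixedNorm_comp_sub hp hq α hα hφ f.2.1 f.2.2
  · intro hnt C hC hu
    refine hnt (hφ.isTrivial_of_eventually_eq_id ?_)
    have hlt := hu.eventually (gt_mem_nhds
      (by norm_num : (0 : ℝ≥0∞) < ((1 / 8 : ℝ≥0) : ℝ≥0∞)))
    filter_upwards [hlt] with t ht
    by_contra hne
    obtain ⟨g, hg, hgn, hgt⟩ :=
      MixedNorm.exists_mixedNorm_comp_sub_gt hp hq hα (hφ.analytic t) hne
    let G : MixedNorm.mixedNormSpace p q α hp hq := ⟨g, hg, hgn.trans_lt ENNReal.one_lt_top⟩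
    set T : MixedNorm.mixedNormSpace p q α hp hq →ₗ[ℂ] MixedNorm.mixedNormSpace p q α hp hq :=
      C t - LinearMap.id with hT
    have h1 : MixedNorm.mixedNorm p q α (T G) ≤ MixedNorm.operatorNorm T :=
      le_iSup₂_of_le G hgn le_rfl
    have h2 : (T G : 𝔻 → ℂ) = g ∘ φ t - g := by
      rw [hT, LinearMap.sub_apply, LinearMap.id_apply, AddSubgroupClass.coe_sub, hC t G]
    rw [h2] at h1
    exact absurd (hgt.trans_le (h1.trans ht.le)) (lt_irrefl _)
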